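/- **Setting.** Let $d\ge1$ and let $p=(p_1,\dots,p_d)$ be a fixed probability vector. On a probability space let $Y_0$ be a random vector in $\mathbb R^d$ (for example a fixed one), and for $n\ge 1$ let $X_n$ be a random vector with values in the set of unit coordinate vectors of $\mathbb R^d$, let $D_n=(D_{q,k}(n))_{q,k=1}^d$ be a random real $d\times d$ matrix with integrable entries, and let (with row vectors) $$Y_n=Y_{n-1}+X_nD_n .$$ Let $\mathscr F_n$ be the $\sigma$-field generated by $Y_0$ and by $X_i,Y_i,D_i$, $1\le i\le n$. Write $y^+=(\max(y_1,0),\dots,\max(y_d,0))$, and assume that $$P(X_{n,k}=1\mid\mathscr F_{n-1})=\frac{Y_{n-1,k}^+}{\sum_{j}Y_{n-1,j}^+}\quad\text{a.s.},\qquad k=1,\dots,d,\ n\ge1,$$ where $\frac{Y^+}{\sum_jY_j^+}$ is read as $p$ when $\sum_jY_j^+=0$. Put $N_n=\sum_{m=1}^nX_m$, $H_n=E[D_n\mid\mathscr F_{n-1}]$ and $M_{n,2}=\sum_{m=1}^nX_m(D_m-H_m)$. Norms on $\mathbb R^d$ and on matrices are arbitrary fixed ones (say maximum norms), and $\operatorname{dist}$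 is the corresponding distance from a point to a set. For a real $d\times d$ matrix $H$ let $\lambda_H$ be the largest real part of its complex eigenvalues, and let $S_H=\{v: vH=\lambda_Hv,\ v_k\ge0,\ \sum_kv_k=1\}$. Call $H$ *admissible* if $H_{q,k}\ge0$ for $q\ne k$, there is a column vector $u$ with all $u_k>0$ and $Hu=\lambda_Hu$, and $\lambda_H>0$. Call $H$ *reducible* if some simultaneous permutation of its rows and columns brings it to the form $\begin{pmatrix}A_{11}&A_{12}\\0&A_{22}\end{pmatrix}$ with non-empty square blocks $A_{11},A_{22}$, and *irreducible* otherwise. **Theorem 3.1.** (i) Suppose that $H$ is a random matrix which is almost surely admissible, and that $$\sum_{m=1}^n\|H_m-H\|=o(n)\ \text{ a.s.},\qquad \|M_{n,2}\|=o(n)\ \text{ a.s.}$$ Then almost surely $S_H\neq\emptyset$ and, as $n\to\infty$, $$\operatorname{dist}\Big(\frac{Y_n}{n},\lambda_HS_H\Big)\to0,\quad \operatorname{dist}\Big(\frac{Y_n^+}{n},\lambda_HS_H\Big)\to0,\quad \operatorname{dist}\Big(\frac{Y_n^+}{\sum_jY_{n,j}^+},S_H\Big)\to0,\quad \operatorname{dist}\Big(\frac{N_n}{n},S_H\Big)\to0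 .$$ (ii) If, in addition, $H$ is almost surely irreducible, then there is a random vector $v$ such that almost surely $S_H=\{v\}$ and $$\frac{Y_n}{n}\to\lambda_Hv,\qquad\frac{Y_n^+}{n}\to\lambda_Hv,\qquad\frac{Y_n^+}{\sum_jY_{n,j}^+}\to v,\qquad\frac{N_n}{n}\to v .$$ (iii) Suppose that for every $n\ge1$ the draw $X_n$ and the replacement matrix $D_n$ are conditionally independent given $\mathscr F_{n-1}$. Then the condition $\|M_{n,2}\|=o(n)$ a.s. is satisfied if for all $q,k$ there is a real sequence $c_m=c_{m,q,k}>0$ such that $$\sum_{m=1}^\infty P\big(|D_{q,k}(m)|\ge c_m\mid\mathscr F_{m-1}\big)<\infty\ \text{ a.s.},$$ $$\sum_{m=1}^nE\big[|D_{q,k}(m)|\,I\{|D_{q,k}(m)|\ge c_m\}\mid\mathscr F_{m-1}\big]=o(n)\ \text{ a.s.},$$ $$\sum_{m=1}^\infty\frac{E\big[\widetilde D_{q,k}(m)^2\mid\mathscr F_{m-1}\big]}{m^2}<\infty\ \text{ a.s.},$$ where $\widetilde D_{q,k}(m)=D_{q,k}(m)I\{|D_{q,k}(m)|\le c_m\}-E\big[D_{q,k}(m)I\{|D_{q,k}(m)|\le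 c_m\}\mid\mathscr F_{m-1}\big]$. -/

import Mathlib

open Filter Topology MeasureTheory Asymptotics
open scoped Matrix Pointwise ProbabilityTheory Matrix.Norms.Elementwise

/-! Vectors are row vectors in `Fin d → ℝ`. Vectors and matrices carry the maximum norm; since the
dimension is finite, all statements below are the same for any other choice of norms. -/

namespace FriedmanUrn

noncomputable section

/-- The product (Borel) sigma-algebra on the space of matrices. -/
instance matrixMeasurableSpace {d : ℕ} : MeasurableSpace (Matrix (Fin d) (Fin d) ℝ) :=
  inferInstanceAs (MeasurableSpace (Fin d → Fin d → ℝ))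

/-- The largest real part of the (complex) eigenvalues of the real square matrix `H`. -/
def lam {d : ℕ} (H : Matrix (Fin d) (Fin d) ℝ) : ℝ :=
  sSup {x : ℝ | ∃ z : ℂ,
    Module.End.HasEigenvalue (Matrix.toLin' (H.map (algebraMap ℝ ℂ))) z ∧ x = z.re}

/-- The probability vectors `v` with `v H = lam H • v`. -/
def leftSimplex {d : ℕ} (H : Matrix (Fin d) (Fin d) ℝ) : Set (Fin d → ℝ) :=
  {v | v ∈ stdSimplex ℝ (Fin d) ∧ v ᵥ* H = lam H • v}

/-- The standing assumption on the limit matrix: nonnegative off-diagonal entries, a right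
eigenvector for `lam H` with positive entries, and `lam H > 0`. -/
structure Admissible {d : ℕ} (H : Matrix (Fin d) (Fin d) ℝ) : Prop where
  offDiag_nonneg : ∀ q k, q ≠ k → 0 ≤ H q k
  exists_right : ∃ u : Fin d → ℝ, (∀ k, 0 < u k) ∧ H *ᵥ u = lam H • u
  lam_pos : 0 < lam H

/-- A simultaneous permutation of rows and columns brings `A` into block upper triangular form,
with square diagonal blocks of sizes `r` and `d - r`, neither of them empty. -/
def Reducible {d : ℕ} (A : Matrix (Fin d) (Fin d) ℝ) : Prop :=
  ∃ (σ : Equiv.Perm (Fin d)) (r : ℕ), 0 < r ∧ r < d ∧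
    ∀ i j : Fin d, r ≤ (i : ℕ) → (j : ℕ) < r → A.submatrix σ σ i j = 0

/-- The entrywise positive part of a vector. -/
def posVec {d : ℕ} (y : Fin d → ℝ) : Fin d → ℝ := fun k => max (y k) 0

/-- The normalised composition `y⁺ / ∑ j, y⁺ j`, where `0 / 0` is read as `p`. -/
def composition {d : ℕ} (p y : Fin d → ℝ) : Fin d → ℝ := fun k =>
  if ∑ j, posVec y j = 0 then p k else posVec y k / ∑ j, posVec y j

variable {Ω : Type*} {d : ℕ}

/-- The history of the urn up to time `n`, generated by `Y 0` and by `X i`, `Y i`, `D i` for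
`1 ≤ i ≤ n`. (A deterministic `Y 0` contributes nothing.) -/
@[reducible] def history (X Y : ℕ → Ω → Fin d → ℝ) (D : ℕ → Ω → Matrix (Fin d) (Fin d) ℝ) (n : ℕ) :
    MeasurableSpace Ω :=
  MeasurableSpace.comap (Y 0) inferInstance ⊔
    ⨆ (i : ℕ) (_ : 1 ≤ i ∧ i ≤ n), (MeasurableSpace.comap (X i) inferInstance ⊔
      MeasurableSpace.comap (Y i) inferInstance ⊔ MeasurableSpace.comap (D i) inferInstance)

/-- The generalized Friedman urn: `Y n` is the composition after `n` stages, and, for `n ≥ 1`,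
`X n` is the result of the `n`-th draw (a unit coordinate vector) and `D n` is the replacement
matrix at stage `n`. The values of `X 0` and `D 0` play no role. -/
structure IsUrn [MeasurableSpace Ω] (μ : Measure Ω) (p : Fin d → ℝ)
    (X Y : ℕ → Ω → Fin d → ℝ) (D : ℕ → Ω → Matrix (Fin d) (Fin d) ℝ) : Prop where
  p_mem : p ∈ stdSimplex ℝ (Fin d)
  measurable_init : Measurable (Y 0)
  measurable_draw : ∀ n, 1 ≤ n → Measurable (X n)
  measurable_replacement : ∀ n, 1 ≤ n → Measurable (D n)
  integrable_replacement : ∀ n, 1 ≤ n → ∀ q k, Integrable (fun ω => D n ω q k) μ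
  draw_unit : ∀ n, 1 ≤ n → ∀ ω, ∃ k, X n ω = Pi.single k 1
  step : ∀ n ω, Y (n + 1) ω = Y n ω + X (n + 1) ω ᵥ* D (n + 1) ω
  selection : ∀ n k, μ⟦{ω | X (n + 1) ω k = 1} | history X Y D n⟧
    =ᵐ[μ] fun ω => composition p (Y n ω) k

/-- Given the past, the draw and the replacement matrix of each stage are independent. -/
def DrawCondIndep [MeasurableSpace Ω] (μ : Measure Ω)
    (X Y : ℕ → Ω → Fin d → ℝ) (D : ℕ → Ω → Matrix (Fin d) (Fin d) ℝ) : Prop :=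
  ∀ (n : ℕ) (k : Fin d) (B : Set (Matrix (Fin d) (Fin d) ℝ)), MeasurableSet B →
    μ⟦{ω | X (n + 1) ω k = 1} ∩ D (n + 1) ⁻¹' B | history X Y D n⟧
      =ᵐ[μ] μ⟦{ω | X (n + 1) ω k = 1} | history X Y D n⟧ *
        μ⟦D (n + 1) ⁻¹' B | history X Y D n⟧

/-- The conditional mean of `D m` given the history up to time `m - 1` (used for `m ≥ 1`). -/
def condMean [MeasurableSpace Ω] (μ : Measure Ω)
    (X Y : ℕ → Ω → Fin d → ℝ) (D : ℕ → Ω → Matrix (Fin d) (Fin d) ℝ) (m : ℕ) (ω : Ω) :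
    Matrix (Fin d) (Fin d) ℝ :=
  Matrix.of fun q k => (μ[fun ω' => D m ω' q k | history X Y D (m - 1)]) ω

/-- The sum of `X m (D m - E[D m | past])` over `1 ≤ m ≤ n`. -/
def M2 [MeasurableSpace Ω] (μ : Measure Ω)
    (X Y : ℕ → Ω → Fin d → ℝ) (D : ℕ → Ω → Matrix (Fin d) (Fin d) ℝ) (n : ℕ) (ω : Ω) :
    Fin d → ℝ :=
  ∑ m ∈ Finset.Icc 1 n, X m ω ᵥ* (D m ω - condMean μ X Y D m ω)

/-- The numbers of draws of each type in the first `n` stages. -/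
def drawCount (X : ℕ → Ω → Fin d → ℝ) (n : ℕ) (ω : Ω) : Fin d → ℝ :=
  ∑ m ∈ Finset.Icc 1 n, X m ω

/-- The entry `D q k` at stage `m`, truncated at the level `c`. -/
def truncEntry (D : ℕ → Ω → Matrix (Fin d) (Fin d) ℝ) (q k : Fin d) (c : ℝ) (m : ℕ) :
    Ω → ℝ :=
  {ω | |D m ω q k| ≤ c}.indicator fun ω => D m ω q k

/-- The truncated entry centred at its conditional mean given the past (used for `m ≥ 1`). -/
def truncCentred [MeasurableSpace Ω] (μ : Measure Ω)
    (X Y : ℕ → Ω → Fin d → ℝ) (D : ℕ → Ω → Matrix (Fin d) (Fin d) ℝ)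
    (q k : Fin d) (c : ℝ) (m : ℕ) : Ω → ℝ :=
  fun ω => truncEntry D q k c m ω - (μ[truncEntry D q k c m | history X Y D (m - 1)]) ω

/-- The three truncation conditions for the entry `(q, k)` with truncation levels `c m`. -/
structure TruncationConditions [MeasurableSpace Ω] (μ : Measure Ω)
    (X Y : ℕ → Ω → Fin d → ℝ) (D : ℕ → Ω → Matrix (Fin d) (Fin d) ℝ)
    (q k : Fin d) (c : ℕ → ℝ) : Prop where
  pos : ∀ m, 1 ≤ m → 0 < c m
  tail : ∀ᵐ ω ∂μ, Summable fun m : ℕ =>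
    (μ⟦{ω' | c (m + 1) ≤ |D (m + 1) ω' q k|} | history X Y D m⟧) ω
  tail_mean : ∀ᵐ ω ∂μ, (fun n : ℕ => ∑ m ∈ Finset.Icc 1 n,
      (μ[{ω' | c m ≤ |D m ω' q k|}.indicator (fun ω' => |D m ω' q k|) |
        history X Y D (m - 1)]) ω) =o[atTop] fun n : ℕ => (n : ℝ)
  variance : ∀ᵐ ω ∂μ, Summable fun m : ℕ =>
    (μ[fun ω' => truncCentred μ X Y D q k (c (m + 1)) (m + 1) ω' ^ 2 | history X Y D m]) ω
      / ((m : ℝ) + 1) ^ 2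

end

end FriedmanUrn

namespace FriedmanUrn

/-! Summing the replacements gives `Y n = N n * H + o(n)`, where `N n` is the draw count: replacing
the conditional means by `H` costs `o(n)`, and so does the martingale `M2`. The draws minus their
conditional probabilities are bounded martingale differences, so `N n` is also the sum of the
compositions up to `o(n)`. From here on each path is treated deterministically (`urn_asymptotics`).

Pairing with the positive right eigenvector `u` shows that `Y n` has positive mass of order `n`. A
negative coordinate is never drawn and off-diagonal entries are nonnegative, so its drift is
nonnegative and negative parts are `o(n)` (`isLittleO_max_zero_sub`). Hence the composition is `a n
• Y n + o(1)` with `a n` of exact order `1 / n`, and `Y n` is the sum of `a m • Y m` for `m < n`,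
times `H`, up to `o(n)`.

Along a column eigenvector for `z` this recursion grows like `exp (z ∑ a m)`, while along `u` it
grows like `exp (λ ∑ a m)` and is of exact order `n`. So components with `re z < λ` are `o(n)`
(`isLittleO_of_recursion`); no limit of `n * a n` is needed. The existence of `u > 0` forces every
other eigenvalue to have smaller real part and makes `λ` semisimple, so these components fill the
range of `H - λ` (`mulVec_sub_smul_mem`). Therefore `Y n * (H - λ) = o(n)`; compositions and draw
frequencies are asymptotically left eigenvectors in the simplex, and compactness turns this into
convergence to `leftSimplex H`. Irreducibility makes that set a single point.

For the last part, conditional Borel-Cantelli removes the truncation, conditional independence keeps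
the sampled truncated entries martingale differences, and a martingale strong law applies. -/

/-- **Kronecker's lemma** with weights `i + 1`. -/
theorem isLittleO_sum_of_tendsto_sum_div {x : ℕ → ℝ} {s : ℝ}
    (h : Tendsto (fun n => ∑ i ∈ Finset.range n, x i / ((i : ℝ) + 1)) atTop (𝓝 s)) :
    (fun n => ∑ i ∈ Finset.range n, x i) =o[atTop] fun n : ℕ => (n : ℝ) := by
  set T : ℕ → ℝ := fun n => ∑ i ∈ Finset.range n, x i / ((i : ℝ) + 1) - s with hT
  have hT0 : Tendsto T atTop (𝓝 0) := by simpa [hT] using h.sub_const s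
  have h1 : (fun n : ℕ => (n : ℝ) * T n) =o[atTop] fun n : ℕ => (n : ℝ) := by
    simpa using (isBigO_refl (fun n : ℕ => (n : ℝ)) atTop).mul_isLittleO
      ((isLittleO_one_iff ℝ).2 hT0)
  -- Summation by parts: the sum of `x i` over `i < n` equals `n * T n` minus the sum of `T i` over
  -- `i < n`, which is `o(n)` by Cesàro.
  refine (h1.sub (isLittleO_sum_range_of_tendsto_zero hT0)).congr_left fun n => ?_
  induction n with
  | zero => simp
  | succ n ih =>
    have hs : T (n + 1) = T n + x n / ((n : ℝ) + 1) := by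
      simp only [hT, Finset.sum_range_succ]; ring
    have hn : (n : ℝ) + 1 ≠ 0 := by positivity
    rw [Finset.sum_range_succ, Finset.sum_range_succ, ← ih, hs]
    push_cast
    field_simp
    ring

/-! ### Martingale convergence and a strong law. -/

section Martingale

variable {Ω : Type*} {m0 : MeasurableSpace Ω} {μ : Measure Ω} [IsProbabilityMeasure μ]

/-- The sum of the conditional variances that is stopped before it exceeds `K` is at most `K`. -/
theorem sum_indicator_le {v : ℕ → ℝ} (hv : ∀ n, 0 ≤ v n) {K : ℝ} (hK : 0 ≤ K) (n : ℕ) :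
    ∑ i ∈ Finset.range n, (if ∑ j ∈ Finset.range (i + 1), v j ≤ K then v i else 0) ≤ K := by
  induction n with
  | zero => simpa
  | succ n ih =>
    rw [Finset.sum_range_succ]
    split_ifs with h
    · rw [Finset.sum_range_succ] at h
      refine le_trans ?_ h
      gcongr with i hi
      split_ifs <;> simp [hv i]
    · simpa using ih

/-- Martingale differences whose second moments have bounded partial sums are a.s. summable. -/
theorem ae_tendsto_sum_of_integral_sq_le (ℱ : Filtration ℕ m0) {ξ : ℕ → Ω → ℝ}
    (hadp : ∀ n, StronglyMeasurable[ℱ (n + 1)] (ξ n)) (hL2 : ∀ n, MemLp (ξ n) 2 μ)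
    (hmd : ∀ n, μ[ξ n | ℱ n] =ᵐ[μ] 0) {K : ℝ}
    (hK : ∀ n, ∑ i ∈ Finset.range n, ∫ ω, ξ i ω ^ 2 ∂μ ≤ K) :
    ∀ᵐ ω ∂μ, ∃ s, Tendsto (fun n => ∑ i ∈ Finset.range n, ξ i ω) atTop (𝓝 s) := by
  set M : ℕ → Ω → ℝ := fun n ω => ∑ i ∈ Finset.range n, ξ i ω with hM
  have hMs : ∀ n, M (n + 1) = M n + ξ n := fun n => by
    ext ω; simp [hM, Finset.sum_range_succ]
  have hMadp : StronglyAdapted ℱ M := fun n =>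
    Finset.stronglyMeasurable_fun_sum _ fun i hi =>
      (hadp i).mono (ℱ.mono (Finset.mem_range.1 hi))
  have hML2 : ∀ n, MemLp (M n) 2 μ := fun n => memLp_finsetSum _ fun i _ => hL2 i
  have hint : ∀ n, Integrable (M n) μ := fun n => (hML2 n).integrable (by norm_num)
  have hmart : Martingale M ℱ μ := by
    refine martingale_of_condExp_sub_eq_zero_nat hMadp hint fun n => ?_
    rw [hMs, add_sub_cancel_left]
    exact hmd n
  -- Orthogonality of increments: `M n` is known at time `n`, when `ξ n` has conditional mean zero.
  have hcross : ∀ n, ∫ ω, M n ω * ξ n ω ∂μ = 0 := fun n => by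
    have hI : Integrable (M n * ξ n) μ := (hML2 n).integrable_mul (hL2 n)
    have h1 := condExp_mul_of_stronglyMeasurable_left (m := ℱ n) (hMadp n) hI
      ((hL2 n).integrable (by norm_num))
    have h2 := integral_condExp (μ := μ) (f := M n * ξ n) (ℱ.le n)
    rw [show (∫ ω, M n ω * ξ n ω ∂μ) = ∫ ω, (M n * ξ n) ω ∂μ from rfl, ← h2]
    refine integral_eq_zero_of_ae ?_
    filter_upwards [h1, hmd n] with ω h3 h4
    simp [h3, h4]
  have hsq : ∀ n, ∫ ω, M n ω ^ 2 ∂μ = ∑ i ∈ Finset.range n, ∫ ω, ξ i ω ^ 2 ∂μ := by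
    intro n
    induction n with
    | zero => simp [hM]
    | succ n ih =>
      rw [Finset.sum_range_succ, ← ih, hMs]
      have h0 : ∀ ω, (M n + ξ n) ω ^ 2 = M n ω ^ 2 + (2 * (M n ω * ξ n ω) + ξ n ω ^ 2) :=
        fun ω => by simp only [Pi.add_apply]; ring
      have hI : Integrable (fun ω => M n ω * ξ n ω) μ := (hML2 n).integrable_mul (hL2 n)
      simp only [h0]
      have hI' : Integrable (fun ω => 2 * (M n ω * ξ n ω) + ξ n ω ^ 2) μ :=
        (hI.const_mul 2).add (hL2 n).integrable_sq
      rw [integral_add (hML2 n).integrable_sq hI',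
        integral_add (hI.const_mul 2) (hL2 n).integrable_sq, integral_const_mul, hcross]
      ring
  -- Doob's theorem asks for an `L¹` bound; it comes from `|x| ≤ 1 + x ^ 2`.
  refine hmart.submartingale.exists_ae_tendsto_of_bdd (R := (1 + K).toNNReal) fun n => ?_
  have h1 : eLpNorm (M n) 1 μ = ENNReal.ofReal (∫ ω, ‖M n ω‖ ∂μ) := by
    rw [eLpNorm_one_eq_lintegral_enorm, ofReal_integral_norm_eq_lintegral_enorm (hint n)]
  rw [h1]
  refine ENNReal.ofReal_le_ofReal ?_
  calc ∫ ω, ‖M n ω‖ ∂μ ≤ ∫ ω, (1 + M n ω ^ 2) ∂μ := by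
        refine integral_mono (hint n).norm ((integrable_const 1).add (hML2 n).integrable_sq)
          fun ω => ?_
        simp only [Real.norm_eq_abs]
        nlinarith [sq_abs (M n ω), sq_nonneg (|M n ω| - 1), abs_nonneg (M n ω)]
    _ = 1 + ∑ i ∈ Finset.range n, ∫ ω, ξ i ω ^ 2 ∂μ := by
        rw [integral_add (integrable_const 1) (hML2 n).integrable_sq, hsq]; simp
    _ ≤ 1 + K := by linarith [hK n]

/-- A sum of square-integrable martingale differences converges almost surely if the sum of
the conditional variances does. -/
theorem ae_tendsto_sum_of_summable_condExp_sq (ℱ : Filtration ℕ m0) {ξ : ℕ → Ω → ℝ}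
    (hadp : ∀ n, StronglyMeasurable[ℱ (n + 1)] (ξ n)) (hL2 : ∀ n, MemLp (ξ n) 2 μ)
    (hmd : ∀ n, μ[ξ n | ℱ n] =ᵐ[μ] 0)
    (hvar : ∀ᵐ ω ∂μ, Summable fun n => (μ[fun ω => ξ n ω ^ 2 | ℱ n]) ω) :
    ∀ᵐ ω ∂μ, ∃ s, Tendsto (fun n => ∑ i ∈ Finset.range n, ξ i ω) atTop (𝓝 s) := by
  set v : ℕ → Ω → ℝ := fun n => μ[fun ω => ξ n ω ^ 2 | ℱ n] with hv
  have hv0 : ∀ᵐ ω ∂μ, ∀ n, 0 ≤ v n ω := ae_all_iff.2 fun n =>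
    condExp_nonneg (Eventually.of_forall fun ω => sq_nonneg (ξ n ω))
  have hvm : ∀ n, StronglyMeasurable[ℱ n] (v n) := fun n => stronglyMeasurable_condExp
  -- Localisation: `v n` is already `ℱ n`-measurable, so `A K n`, which involves `v 0, …, v n`, may
  -- multiply `ξ n` without destroying the martingale difference property.
  set A : ℕ → ℕ → Set Ω := fun K n => {ω | ∑ j ∈ Finset.range (n + 1), v j ω ≤ K} with hA
  have hAm : ∀ K n, MeasurableSet[ℱ n] (A K n) := fun K n => by
    have : StronglyMeasurable[ℱ n] fun ω => ∑ j ∈ Finset.range (n + 1), v j ω :=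
      Finset.stronglyMeasurable_fun_sum _ fun i hi =>
        (hvm i).mono (ℱ.mono (Nat.lt_succ_iff.1 (Finset.mem_range.1 hi)))
    exact this.measurable measurableSet_Iic
  have key : ∀ K : ℕ, ∀ᵐ ω ∂μ, ∃ s,
      Tendsto (fun n => ∑ i ∈ Finset.range n, (A K i).indicator (ξ i) ω) atTop (𝓝 s) := by
    intro K
    refine ae_tendsto_sum_of_integral_sq_le ℱ (K := K)
      (fun n => (hadp n).indicator (ℱ.mono n.le_succ _ (hAm K n)))
      (fun n => (hL2 n).indicator (ℱ.le n _ (hAm K n))) (fun n => ?_) fun n => ?_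
    · filter_upwards [condExp_indicator ((hL2 n).integrable (by norm_num)) (hAm K n), hmd n]
        with ω h1 h2
      rw [h1]
      by_cases h : ω ∈ A K n <;> simp [h, h2]
    · have hi : ∀ i, ∫ ω, (A K i).indicator (ξ i) ω ^ 2 ∂μ
          = ∫ ω, (A K i).indicator (v i) ω ∂μ := fun i => by
        have h0 : (fun ω => (A K i).indicator (ξ i) ω ^ 2)
            = (A K i).indicator fun ω => ξ i ω ^ 2 := by
          ext ω; by_cases h : ω ∈ A K i <;> simp [h]
        rw [h0, integral_indicator (ℱ.le i _ (hAm K i)), integral_indicator (ℱ.le i _ (hAm K i)),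
          hv, setIntegral_condExp (ℱ.le i) (hL2 i).integrable_sq (hAm K i)]
      simp only [hi]
      rw [← integral_finsetSum _ fun i _ =>
        (integrable_condExp (m := ℱ i)).indicator (ℱ.le i _ (hAm K i))]
      have hle : (fun ω => ∑ i ∈ Finset.range n, (A K i).indicator (v i) ω) ≤ᵐ[μ] fun _ => (K : ℝ) := by
        filter_upwards [hv0] with ω h0
        refine le_trans (le_of_eq ?_) (sum_indicator_le h0 (Nat.cast_nonneg K) n)
        refine Finset.sum_congr rfl fun i _ => ?_
        simp [Set.indicator_apply, hA]
      refine (integral_mono_ae ?_ (integrable_const _) hle).trans (by simp)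
      exact integrable_finsetSum _ fun i _ =>
        (integrable_condExp (m := ℱ i)).indicator (ℱ.le i _ (hAm K i))
  filter_upwards [ae_all_iff.2 key, hvar, hv0] with ω hω hs h0
  -- For `K` above the total conditional variance of this path, the localised series is the original
  -- one.
  obtain ⟨K, hK⟩ := exists_nat_ge (∑' n, v n ω)
  obtain ⟨s, hs'⟩ := hω K
  refine ⟨s, hs'.congr fun n => Finset.sum_congr rfl fun i _ => ?_⟩
  refine Set.indicator_of_mem ?_ _
  exact (hs.sum_le_tsum _ fun j _ => h0 j).trans hK

/-- A strong law of large numbers for martingale differences. -/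
theorem ae_isLittleO_sum_of_summable_condExp_sq (ℱ : Filtration ℕ m0) {ξ : ℕ → Ω → ℝ}
    (hadp : ∀ n, StronglyMeasurable[ℱ (n + 1)] (ξ n)) (hL2 : ∀ n, MemLp (ξ n) 2 μ)
    (hmd : ∀ n, μ[ξ n | ℱ n] =ᵐ[μ] 0)
    (hvar : ∀ᵐ ω ∂μ, Summable fun n : ℕ =>
      (μ[fun ω => ξ n ω ^ 2 | ℱ n]) ω / ((n : ℝ) + 1) ^ 2) :
    ∀ᵐ ω ∂μ, (fun n => ∑ i ∈ Finset.range n, ξ i ω) =o[atTop] fun n : ℕ => (n : ℝ) := by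
  have h : ∀ᵐ ω ∂μ, ∃ s,
      Tendsto (fun n => ∑ i ∈ Finset.range n, (((i : ℝ) + 1)⁻¹ • ξ i) ω) atTop (𝓝 s) := by
    refine ae_tendsto_sum_of_summable_condExp_sq ℱ (fun n => (hadp n).const_smul _)
      (fun n => (hL2 n).const_smul _) (fun n => ?_) ?_
    · filter_upwards [condExp_smul (μ := μ) ((n : ℝ) + 1)⁻¹ (ξ n) (ℱ n), hmd n] with ω h1 h2
      simp [h1, h2]
    · have h1 : ∀ᵐ ω ∂μ, ∀ n : ℕ, (μ[fun ω => (((n : ℝ) + 1)⁻¹ • ξ n) ω ^ 2 | ℱ n]) ω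
          = (μ[fun ω => ξ n ω ^ 2 | ℱ n]) ω / ((n : ℝ) + 1) ^ 2 := ae_all_iff.2 fun n => by
        have h0 : (fun ω => (((n : ℝ) + 1)⁻¹ • ξ n) ω ^ 2)
            = (((n : ℝ) + 1) ^ 2)⁻¹ • fun ω => ξ n ω ^ 2 := by
          ext ω; simp [mul_pow]
        rw [h0]
        filter_upwards [condExp_smul (μ := μ) (((n : ℝ) + 1) ^ 2)⁻¹ (fun ω => ξ n ω ^ 2) (ℱ n)]
          with ω h2
        rw [h2, Pi.smul_apply, smul_eq_mul, div_eq_inv_mul]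
      filter_upwards [hvar, h1] with ω h2 h3
      exact h2.congr fun n => (h3 n).symm
  filter_upwards [h] with ω ⟨s, hs⟩
  refine isLittleO_sum_of_tendsto_sum_div (s := s) (hs.congr fun n => ?_)
  refine Finset.sum_congr rfl fun i _ => ?_
  simp [div_eq_inv_mul]

end Martingale

/-! ### Spectral consequences of a positive eigenvector; irreducibility. -/

section LinearAlgebra

variable {d : ℕ}

/-- A nonnegative matrix `B` with `B u = κ u` is bounded by `κ` in the norm weighted by `u`. -/
theorem norm_map_mulVec_le {B : Matrix (Fin d) (Fin d) ℝ} (hB : ∀ i j, 0 ≤ B i j)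
    {u : Fin d → ℝ} {κ : ℝ} (hBu : B *ᵥ u = κ • u) {h : Fin d → ℂ} {M : ℝ}
    (hM : ∀ k, ‖h k‖ ≤ M * u k) (k : Fin d) :
    ‖(B.map (algebraMap ℝ ℂ) *ᵥ h) k‖ ≤ M * (κ * u k) := by
  have h1 : ∑ j, B k j * u j = κ * u k := by
    simpa [Matrix.mulVec, dotProduct] using congrFun hBu k
  calc ‖(B.map (algebraMap ℝ ℂ) *ᵥ h) k‖ ≤ ∑ j, ‖(B k j : ℂ) * h j‖ := by
        simpa [Matrix.mulVec, dotProduct] using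
          norm_sum_le Finset.univ fun j => (B k j : ℂ) * h j
    _ ≤ ∑ j, B k j * (M * u j) := by
        refine Finset.sum_le_sum fun j _ => ?_
        rw [norm_mul, Complex.norm_real, Real.norm_of_nonneg (hB k j)]
        exact mul_le_mul_of_nonneg_left (hM j) (hB k j)
    _ = M * ∑ j, B k j * u j := by rw [Finset.mul_sum]; exact Finset.sum_congr rfl fun j _ => by ring
    _ = _ := by rw [h1]

/-- A shift by a large multiple of the identity makes all entries nonnegative. -/
theorem exists_shift_nonneg {H : Matrix (Fin d) (Fin d) ℝ} (hoff : ∀ q k, q ≠ k → 0 ≤ H q k)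
    (l : ℝ) : ∃ c : ℝ, 0 < l + c ∧ ∀ i j, 0 ≤ (H + c • (1 : Matrix (Fin d) (Fin d) ℝ)) i j := by
  refine ⟨1 + |l| + ∑ q, |H q q|, ?_, fun i j => ?_⟩
  · have : 0 ≤ ∑ q, |H q q| := Finset.sum_nonneg fun q _ => abs_nonneg _
    linarith [neg_abs_le l]
  · by_cases hij : i = j
    · subst hij
      have : |H i i| ≤ ∑ q, |H q q| :=
        Finset.single_le_sum (f := fun q => |H q q|) (fun q _ => abs_nonneg _) (Finset.mem_univ i)
      simp only [Matrix.add_apply, Matrix.smul_apply, Matrix.one_apply_eq, smul_eq_mul, mul_one]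
      linarith [neg_abs_le (H i i), abs_nonneg l]
    · simpa [Matrix.one_apply_ne hij] using hoff i j hij

theorem map_shift_mulVec (H : Matrix (Fin d) (Fin d) ℝ) (c : ℝ) (h : Fin d → ℂ) :
    (H + c • (1 : Matrix (Fin d) (Fin d) ℝ)).map (algebraMap ℝ ℂ) *ᵥ h
      = H.map (algebraMap ℝ ℂ) *ᵥ h + (c : ℂ) • h := by
  have : (H + c • (1 : Matrix (Fin d) (Fin d) ℝ)).map (algebraMap ℝ ℂ)
      = H.map (algebraMap ℝ ℂ) + (c : ℂ) • (1 : Matrix (Fin d) (Fin d) ℂ) := by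
    ext i j
    by_cases hij : i = j <;> simp [hij]
  rw [this, Matrix.add_mulVec, Matrix.smul_mulVec, Matrix.one_mulVec]

variable {H : Matrix (Fin d) (Fin d) ℝ} {u : Fin d → ℝ} {l : ℝ}

theorem shift_mulVec (hHu : H *ᵥ u = l • u) (c : ℝ) :
    (H + c • (1 : Matrix (Fin d) (Fin d) ℝ)) *ᵥ u = (l + c) • u := by
  rw [Matrix.add_mulVec, Matrix.smul_mulVec, Matrix.one_mulVec, hHu, add_smul]

/-- If a matrix with nonnegative off-diagonal entries has a positive eigenvector with
eigenvalue `l`, then every other complex eigenvalue has a smaller real part. -/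
theorem eq_or_re_lt_of_mulVec_eq_smul (hoff : ∀ q k, q ≠ k → 0 ≤ H q k) (hu : ∀ k, 0 < u k)
    (hHu : H *ᵥ u = l • u) {z : ℂ} {h : Fin d → ℂ} (hh : h ≠ 0)
    (hz : H.map (algebraMap ℝ ℂ) *ᵥ h = z • h) : z = l ∨ z.re < l := by
  obtain ⟨k₀, hk₀⟩ := Function.ne_iff.1 hh
  have : Nonempty (Fin d) := ⟨k₀⟩
  obtain ⟨k, hk⟩ := Finite.exists_max fun k => ‖h k‖ / u k
  set M := ‖h k‖ / u k with hMdef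
  have hM : ∀ j, ‖h j‖ ≤ M * u j := fun j => (div_le_iff₀ (hu j)).1 (hk j)
  have hMpos : 0 < M := lt_of_lt_of_le (div_pos (norm_pos_iff.2 hk₀) (hu k₀)) (hk k₀)
  obtain ⟨c, hc, hB⟩ := exists_shift_nonneg hoff l
  have h1 := norm_map_mulVec_le hB (shift_mulVec hHu c) hM k
  rw [map_shift_mulVec, hz, ← add_smul, Pi.smul_apply, norm_smul,
    show ‖h k‖ = M * u k by rw [hMdef, div_mul_cancel₀ _ (hu k).ne']] at h1
  -- At a coordinate maximising `‖h k‖ / u k` the weighted bound is read off for `h` itself. The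
  -- resulting disc about `-c` touches the line `re z = l` only at `l`.
  have h2 : ‖z + c‖ ≤ l + c := by
    have : 0 < M * u k := mul_pos hMpos (hu k)
    refine le_of_mul_le_mul_right ?_ this
    linarith [h1]
  have h3 : (z.re + c) ^ 2 + z.im ^ 2 ≤ (l + c) ^ 2 := by
    have h4 : ‖z + c‖ ^ 2 = (z.re + c) ^ 2 + z.im ^ 2 := by
      rw [Complex.sq_norm, Complex.normSq_apply]; simp; ring
    rw [← h4]
    exact pow_le_pow_left₀ (norm_nonneg _) h2 2
  rcases lt_or_ge z.re l with h5 | h5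
  · exact Or.inr h5
  · left
    have h6 : (l + c) ^ 2 ≤ (z.re + c) ^ 2 := pow_le_pow_left₀ hc.le (by linarith) 2
    have h7 : z.im = 0 := by
      have : z.im ^ 2 ≤ 0 := by linarith
      exact pow_eq_zero_iff (two_ne_zero) |>.1 (le_antisymm this (sq_nonneg _))
    have h8 : z.re ≤ l := by
      have : z.re + c ≤ l + c := abs_le_of_sq_le_sq' (by nlinarith) hc.le |>.2
      linarith
    exact Complex.ext (by simpa using le_antisymm h8 h5) (by simpa using h7)

/-- The eigenvalue of a positive eigenvector is semisimple. -/
theorem eq_zero_of_mulVec_eq_add (hoff : ∀ q k, q ≠ k → 0 ≤ H q k) (hu : ∀ k, 0 < u k)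
    (hHu : H *ᵥ u = l • u) {h g : Fin d → ℂ}
    (hh : H.map (algebraMap ℝ ℂ) *ᵥ h = (l : ℂ) • h + g)
    (hg : H.map (algebraMap ℝ ℂ) *ᵥ g = (l : ℂ) • g) : g = 0 := by
  obtain ⟨c, hc, hB⟩ := exists_shift_nonneg hoff l
  set B := H + c • (1 : Matrix (Fin d) (Fin d) ℝ) with hBdef
  have hBu : B *ᵥ u = (l + c) • u := shift_mulVec hHu c
  have hκ : ((l : ℂ) + c) ≠ 0 := by exact_mod_cast hc.ne'
  have hBg : B.map (algebraMap ℝ ℂ) *ᵥ g = ((l : ℂ) + c) • g := by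
    rw [map_shift_mulVec, hg, add_smul]
  have hBh : B.map (algebraMap ℝ ℂ) *ᵥ h = ((l : ℂ) + c) • h + g := by
    rw [map_shift_mulVec, hh, add_smul]; abel
  by_contra hne
  obtain ⟨k, hk⟩ := Function.ne_iff.1 hne
  have : Nonempty (Fin d) := ⟨k⟩
  obtain ⟨k₁, hk₁⟩ := Finite.exists_max fun k => ‖h k‖ / u k
  set M := ‖h k₁‖ / u k₁
  have hM : ∀ j, ‖h j‖ ≤ M * u j := fun j => (div_le_iff₀ (hu j)).1 (hk₁ j)
  -- These vectors are the iterates of `h` under `B / (l + c)`, a contraction in the norm weighted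
  -- by `u`. A nonzero `g` would make them grow linearly.
  have key : ∀ n : ℕ, ∀ j, ‖(h + ((n : ℂ) / ((l : ℂ) + c)) • g) j‖ ≤ M * u j := by
    intro n
    induction n with
    | zero => simpa using hM
    | succ n ih =>
      intro j
      have h1 := norm_map_mulVec_le hB hBu ih j
      rw [Matrix.mulVec_add, Matrix.mulVec_smul, hBg, hBh] at h1
      have h2 : ((l : ℂ) + c) • h + g + ((n : ℂ) / ((l : ℂ) + c)) • ((l : ℂ) + c) • g
          = ((l : ℂ) + c) • (h + (((n + 1 : ℕ) : ℂ) / ((l : ℂ) + c)) • g) := by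
        ext i
        simp only [Pi.add_apply, Pi.smul_apply, smul_eq_mul]
        push_cast
        field_simp
        ring
      rw [h2, Pi.smul_apply, norm_smul, ← Complex.ofReal_add, Complex.norm_real,
        Real.norm_of_nonneg hc.le] at h1
      refine le_of_mul_le_mul_left ?_ hc
      push_cast at h1 ⊢
      linarith [h1]
  have hgk : 0 < ‖g k‖ / (l + c) := div_pos (norm_pos_iff.2 hk) hc
  obtain ⟨n, hn⟩ := exists_nat_gt (2 * (M * u k) / (‖g k‖ / (l + c)))
  rw [div_lt_iff₀ hgk] at hn
  have h1 := key n k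
  have h2 : ‖((n : ℂ) / ((l : ℂ) + c)) • g k‖ = n * (‖g k‖ / (l + c)) := by
    rw [norm_smul, norm_div, ← Complex.ofReal_add, Complex.norm_real, Real.norm_of_nonneg hc.le]
    simp; ring
  have h3 : ‖((n : ℂ) / ((l : ℂ) + c)) • g k‖
      ≤ ‖(h + ((n : ℂ) / ((l : ℂ) + c)) • g) k‖ + ‖h k‖ := by
    have := norm_sub_le ((h + ((n : ℂ) / ((l : ℂ) + c)) • g) k) (h k)
    simpa using this
  linarith [hM k]

/-- If a subspace contains every vector that is mapped into it by `H - z` for some `z` with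
real part less than `l`, then it contains the range of `H - l`. -/
theorem mulVec_sub_smul_mem (hoff : ∀ q k, q ≠ k → 0 ≤ H q k) (hu : ∀ k, 0 < u k)
    (hHu : H *ᵥ u = l • u) (S : Submodule ℂ (Fin d → ℂ))
    (hS : ∀ (z : ℂ) (h : Fin d → ℂ), z.re < l →
      H.map (algebraMap ℝ ℂ) *ᵥ h - z • h ∈ S → h ∈ S) (h : Fin d → ℂ) :
    H.map (algebraMap ℝ ℂ) *ᵥ h - (l : ℂ) • h ∈ S := by
  set T : Module.End ℂ (Fin d → ℂ) := Matrix.toLin' (H.map (algebraMap ℝ ℂ)) with hT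
  have hTapp : ∀ z h, (T - algebraMap ℂ (Module.End ℂ (Fin d → ℂ)) z) h
      = H.map (algebraMap ℝ ℂ) *ᵥ h - z • h := fun z h => by
    simp [hT, Matrix.toLin'_apply, Module.algebraMap_end_apply]
  have hmem : h ∈ ⨆ z, T.maxGenEigenspace z := by
    rw [Module.End.iSup_maxGenEigenspace_eq_top]; trivial
  induction hmem using Submodule.iSup_induction' with
  | zero => simp
  | add x y _ _ hx hy =>
    have := S.add_mem hx hy
    rw [Matrix.mulVec_add, smul_add]
    convert this using 1
    abel
  | mem z h hz =>
    obtain ⟨k, hk⟩ := Module.End.mem_maxGenEigenspace _ _ _ |>.1 hz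
    have hk' : ((T - algebraMap ℂ (Module.End ℂ (Fin d → ℂ)) z) ^ k) h = 0 := by
      simpa [Algebra.algebraMap_eq_smul_one] using hk
    clear hk hz
    -- On the generalized eigenspace of `l`, semisimplicity makes `H - l` vanish. The generalized
    -- eigenspaces of the other `z` lie in `S`.
    by_cases hzl : z = l
    · subst hzl
      suffices H.map (algebraMap ℝ ℂ) *ᵥ h - (l : ℂ) • h = 0 by rw [this]; exact S.zero_mem
      induction k generalizing h with
      | zero => simp_all
      | succ k ih =>
        rw [pow_succ, Module.End.mul_apply, hTapp] at hk'
        have h1 := ih _ hk'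
        exact eq_zero_of_mulVec_eq_add hoff hu hHu (h := h) (by abel) (sub_eq_zero.1 h1)
    -- Climb the Jordan chain: `(H - z) h` is killed by a lower power, so it lies in `S` and then so
    -- does `h`. If `z` has real part at least `l`, it is no eigenvalue and `h = 0`.
    · have hmem' : ∀ (k : ℕ) (h : Fin d → ℂ),
          ((T - algebraMap ℂ (Module.End ℂ (Fin d → ℂ)) z) ^ k) h = 0 → h ∈ S := by
        intro k
        induction k with
        | zero => intro h hk'; simp_all
        | succ k ih =>
          intro h hk'
          rw [pow_succ, Module.End.mul_apply, hTapp] at hk'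
          have h1 := ih _ hk'
          by_cases hre : z.re < l
          · exact hS z h hre h1
          · have hinj : ∀ g : Fin d → ℂ, H.map (algebraMap ℝ ℂ) *ᵥ g - z • g = 0 → g = 0 := by
              intro g hg
              by_contra hne
              rcases eq_or_re_lt_of_mulVec_eq_smul hoff hu hHu hne (sub_eq_zero.1 hg) with h2 | h2
              exacts [hzl h2, hre h2]
            have hpow : ∀ (j : ℕ) (g : Fin d → ℂ),
                ((T - algebraMap ℂ (Module.End ℂ (Fin d → ℂ)) z) ^ j) g = 0 → g = 0 := by
              intro j
              induction j with
              | zero => intro g hg; simpa using hg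
              | succ j ihj =>
                intro g hg
                rw [pow_succ, Module.End.mul_apply, hTapp] at hg
                exact hinj g (ihj _ hg)
            rw [hinj h (hpow k _ hk')]
            exact S.zero_mem
      rw [← hTapp]
      refine hmem' k _ ?_
      -- `H - l` commutes with the powers of `H - z`, so it preserves the generalized eigenspace.
      have hcomm : Commute ((T - algebraMap ℂ (Module.End ℂ (Fin d → ℂ)) z) ^ k)
          (T - algebraMap ℂ (Module.End ℂ (Fin d → ℂ)) l) :=
        (((Commute.refl T).sub_right (Algebra.commute_algebraMap_right _ _)).sub_left
          (Algebra.commute_algebraMap_left _ _)).pow_left k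
      rw [← Module.End.mul_apply, hcomm.eq, Module.End.mul_apply, hk', map_zero]

/-- A nonnegative left eigenvector of an irreducible matrix is positive. -/
theorem pos_of_vecMul_eq_smul (hoff : ∀ q k, q ≠ k → 0 ≤ H q k) (hirr : ¬ Reducible H)
    {w : Fin d → ℝ} (hw0 : ∀ k, 0 ≤ w k) (hw : w ᵥ* H = l • w) (hne : w ≠ 0) (k : Fin d) :
    0 < w k := by
  classical
  refine (hw0 k).lt_of_ne' fun hk => hirr ?_
  -- If `w` had a zero, listing its zero set first would exhibit the forbidden block form.
  set r := Fintype.card {i // w i = 0} with hr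
  have hrd : r ≤ d := by simpa using Fintype.card_subtype_le fun i => w i = 0
  obtain ⟨k₀, hk₀⟩ := Function.ne_iff.1 hne
  have hcard : Fintype.card {i : Fin d // (i : ℕ) < r} = Fintype.card {i // w i = 0} := by
    rw [← hr, Fintype.card_subtype]
    rw [Fin.card_filter_val_lt, min_eq_right hrd]
  let e := Fintype.equivOfCardEq hcard
  refine ⟨e.extendSubtype, r, ?_, ?_, fun i j hi hj => ?_⟩
  · exact Fintype.card_pos_iff.2 ⟨⟨k, hk⟩⟩
  · simpa using Fintype.card_subtype_lt (p := fun i => w i = 0) (x := k₀) hk₀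
  · have hi' : w (e.extendSubtype i) ≠ 0 := e.extendSubtype_not_mem i (not_lt.2 hi)
    have hj' : w (e.extendSubtype j) = 0 := e.extendSubtype_mem j hj
    rw [Matrix.submatrix_apply]
    generalize e.extendSubtype i = a at *
    generalize e.extendSubtype j = b at *
    -- Column `b` of `w H = l w` at a zero of `w`: all terms are nonnegative, since the only entry
    -- of uncertain sign, `H b b`, has weight `w b = 0`.
    have h1 : ∑ q, w q * H q b = 0 := by
      have := congrFun hw b
      simpa [Matrix.vecMul, dotProduct, hj'] using this
    have h2 := (Finset.sum_eq_zero_iff_of_nonneg fun q _ => ?_).1 h1 a (Finset.mem_univ a)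
    · exact (mul_eq_zero.1 h2).resolve_left hi'
    · by_cases hq : q = b
      · simp [hq, hj']
      · exact mul_nonneg (hw0 q) (hoff q b hq)

/-- For an irreducible matrix there is at most one normalized left eigenvector. -/
theorem leftSimplex_subsingleton (hoff : ∀ q k, q ≠ k → 0 ≤ H q k) (hirr : ¬ Reducible H) :
    (leftSimplex H).Subsingleton := by
  intro v hv v' hv'
  have hne : ∀ x ∈ leftSimplex H, x ≠ 0 := fun x hx h0 => by
    have := hx.1.2
    simp [h0] at this
  have hpos' := pos_of_vecMul_eq_smul hoff hirr hv'.1.1 hv'.2 (hne v' hv')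
  obtain ⟨k₀, -⟩ := Function.ne_iff.1 (hne v hv)
  have : Nonempty (Fin d) := ⟨k₀⟩
  obtain ⟨k, hk⟩ := Finite.exists_min fun k => v k / v' k
  -- The largest `t` keeping `v - t • v'` nonnegative. The difference vanishes at `k`, so it cannot
  -- be a nonzero nonnegative eigenvector.
  set t := v k / v' k with ht
  have h0 : v - t • v' = 0 := by
    by_contra hne0
    have := pos_of_vecMul_eq_smul hoff hirr (w := v - t • v') (l := lam H) (fun j => ?_) ?_ hne0 k
    · simp [ht, div_mul_cancel₀ _ (hpos' k).ne'] at this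
    · have := (le_div_iff₀ (hpos' j)).1 (hk j)
      simpa using this
    · rw [Matrix.sub_vecMul, Matrix.smul_vecMul, hv.2, hv'.2, smul_sub, smul_comm]
  have h1 : v = t • v' := sub_eq_zero.1 h0
  have h2 : ∑ j, v j = t * ∑ j, v' j := by rw [h1, Finset.mul_sum]; simp
  rw [hv.1.2, hv'.1.2, mul_one] at h2
  rw [h1, ← h2, one_smul]

end LinearAlgebra

/-! ### Comparison of perturbed scalar recursions. -/

section Recursion

/-- The factors are at most `exp (-δ / (n + 1))`, and the harmonic series diverges. -/
theorem tendsto_zero_of_le_one_sub_mul {ρ : ℕ → ℝ} {δ : ℝ} (hδ : 0 < δ) (h0 : ∀ᶠ n in atTop, 0 ≤ ρ n)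
    (h : ∀ᶠ n : ℕ in atTop, ρ (n + 1) ≤ (1 - δ / ((n : ℝ) + 1)) * ρ n) :
    Tendsto ρ atTop (𝓝 0) := by
  obtain ⟨N, hN⟩ := eventually_atTop.1 (h0.and h)
  set E : ℕ → ℝ := fun n => ∑ i ∈ Finset.range n, 1 / ((i : ℝ) + 1) with hE
  have hEt : Tendsto E atTop atTop := Real.tendsto_sum_range_one_div_nat_succ_atTop
  have key : ∀ n, N ≤ n → ρ n ≤ ρ N * Real.exp (δ * E N) * Real.exp (-(δ * E n)) := by
    intro n hn
    induction n, hn using Nat.le_induction with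
    | base => rw [mul_assoc, ← Real.exp_add]; simp
    | succ n hn ih =>
      have h1 : E (n + 1) = E n + 1 / ((n : ℝ) + 1) := by simp [hE, Finset.sum_range_succ]
      have h2 : 1 - δ / ((n : ℝ) + 1) ≤ Real.exp (-(δ / ((n : ℝ) + 1))) := by
        linarith [Real.add_one_le_exp (-(δ / ((n : ℝ) + 1)))]
      calc ρ (n + 1) ≤ (1 - δ / ((n : ℝ) + 1)) * ρ n := (hN n hn).2
        _ ≤ Real.exp (-(δ / ((n : ℝ) + 1))) * ρ n := mul_le_mul_of_nonneg_right h2 (hN n hn).1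
        _ ≤ Real.exp (-(δ / ((n : ℝ) + 1)))
            * (ρ N * Real.exp (δ * E N) * Real.exp (-(δ * E n))) :=
          mul_le_mul_of_nonneg_left ih (Real.exp_nonneg _)
        _ = _ := by
          rw [h1, mul_add, neg_add, Real.exp_add, mul_one_div]; ring
  have hlim : Tendsto (fun n => ρ N * Real.exp (δ * E N) * Real.exp (-(δ * E n))) atTop (𝓝 0) := by
    have := (Real.tendsto_exp_neg_atTop_nhds_zero.comp (hEt.const_mul_atTop hδ)).const_mul
      (ρ N * Real.exp (δ * E N))
    simpa using this
  exact tendsto_of_tendsto_of_tendsto_of_le_of_le' tendsto_const_nhds hlim h0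
    (eventually_atTop.2 ⟨N, key⟩)

/-- Comparison of two perturbed linear recursions with growth rates `l' < l`. -/
theorem tendsto_div_of_recursion {f Θ a η : ℕ → ℝ} {l' l c : ℝ} (hl : l' < l) (hc : 0 < c)
    (hf0 : ∀ n, 0 ≤ f n)
    (hf : ∀ᶠ n in atTop, f (n + 1) ≤ (1 + l' * a n) * f n + η n)
    (hΘ : ∀ᶠ n in atTop, (1 + l * a n) * Θ n - η n ≤ Θ (n + 1))
    (hΘc : ∀ᶠ n : ℕ in atTop, c * n ≤ Θ n) (hac : ∀ᶠ n : ℕ in atTop, c / n ≤ a n)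
    (ha : Tendsto a atTop (𝓝 0)) (hη : Tendsto η atTop (𝓝 0)) :
    Tendsto (fun n => f n / Θ n) atTop (𝓝 0) := by
  have hpos : ∀ᶠ n : ℕ in atTop, 0 < n := eventually_gt_atTop 0
  -- An intermediate rate: the gap `l - l''` absorbs the error in `Θ`, and the gap `l'' - l'` makes
  -- the quotient decay. The half in `δ` pays for the bound `1 + l'' * a n < 2`.
  set l'' := (l + l') / 2 with hl''
  set δ := (l'' - l') * c / 2 with hδ
  have hδ0 : 0 < δ := by have : 0 < l'' - l' := by rw [hl'']; linarith
                         positivity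
  -- The gain per step is bounded below, so an error tending to zero is eventually dominated by any
  -- fixed fraction of it.
  have hcc : ∀ᶠ n : ℕ in atTop, c * c ≤ a n * Θ n := by
    filter_upwards [hΘc, hac, hpos] with n h1 h2 h3
    have h3' : (0 : ℝ) < n := by exact_mod_cast h3
    calc c * c = c / n * (c * n) := by field_simp
      _ ≤ a n * Θ n := mul_le_mul h2 h1 (by positivity) ((by positivity : 0 ≤ c / (n : ℝ)).trans h2)
  -- The excess of `f` over `e * Θ` obeys an error-free recursion of rate `l'`: the total error `(1
  -- + e) * η n` is beaten by `e * (l - l') * (a n * Θ n)`.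
  have key : ∀ e > 0, Tendsto (fun n => max (f n - e * Θ n) 0 / Θ n) atTop (𝓝 0) := by
    intro e he
    refine tendsto_zero_of_le_one_sub_mul hδ0 ?_ ?_
    · filter_upwards [hΘc, hpos] with n h1 h2
      have : (0 : ℝ) < n := by exact_mod_cast h2
      exact div_nonneg (le_max_right _ _) ((by positivity : 0 ≤ c * (n : ℝ)).trans h1)
    · have hη1 : ∀ᶠ n in atTop, (1 + e) * η n < e * (l - l') * (c * c) := by
        have : Tendsto (fun n => (1 + e) * η n) atTop (𝓝 0) := by simpa using hη.const_mul (1 + e)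
        exact this.eventually_lt_const (by have := sub_pos.2 hl; positivity)
      have hη2 : ∀ᶠ n in atTop, η n < (l - l'') * (c * c) :=
        hη.eventually_lt_const (mul_pos (by rw [hl'']; linarith) (by positivity))
      have ha1 : ∀ᶠ n in atTop, 1 / 2 < 1 + l' * a n := by
        have : Tendsto (fun n => 1 + l' * a n) atTop (𝓝 1) := by
          simpa using (ha.const_mul l').const_add 1
        exact this.eventually_const_lt (by norm_num)
      have ha2 : ∀ᶠ n in atTop, 1 + l'' * a n < 2 := by
        have : Tendsto (fun n => 1 + l'' * a n) atTop (𝓝 1) := by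
          simpa using (ha.const_mul l'').const_add 1
        exact this.eventually_lt_const (by norm_num)
      filter_upwards [hf, hΘ, hΘc, hac, hpos, hcc, hη1, hη2, ha1, ha2] with
        n h1 h2 h3 h4 h5 h6 h7 h8 h9 h10
      have hn : (0 : ℝ) < n := by exact_mod_cast h5
      have hΘn : 0 < Θ n := (by positivity : 0 < c * (n : ℝ)).trans_le h3
      have han : 0 < a n := (by positivity : 0 < c / (n : ℝ)).trans_le h4
      have hll : 0 < l'' - l' := by rw [hl'']; linarith
      have hll2 : 0 < l - l'' := by rw [hl'']; linarith
      have hg : f (n + 1) - e * Θ (n + 1) ≤ (1 + l' * a n) * (f n - e * Θ n) := by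
        have h11 := mul_le_mul_of_nonneg_left h2 he.le
        have h12 := mul_le_mul_of_nonneg_left h6 (mul_pos he (sub_pos.2 hl)).le
        nlinarith
      have hg' : max (f (n + 1) - e * Θ (n + 1)) 0 ≤ (1 + l' * a n) * max (f n - e * Θ n) 0 :=
        max_le (hg.trans (mul_le_mul_of_nonneg_left (le_max_left _ _) (by linarith)))
          (mul_nonneg (by linarith) (le_max_right _ _))
      have hΘ' : (1 + l'' * a n) * Θ n ≤ Θ (n + 1) := by
        have h12 := mul_le_mul_of_nonneg_left h6 hll2.le
        nlinarith
      have hl''pos : 0 < 1 + l'' * a n := by nlinarith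
      have hΘn1 : 0 < Θ (n + 1) := (mul_pos hl''pos hΘn).trans_le hΘ'
      have hG : 0 ≤ max (f n - e * Θ n) 0 := le_max_right _ _
      have hfac : 1 + l' * a n ≤ (1 - δ / ((n : ℝ) + 1)) * (1 + l'' * a n) := by
        have h13 : c / ((n : ℝ) + 1) ≤ a n :=
          (div_le_div_of_nonneg_left hc.le hn (by linarith)).trans h4
        have h14 : δ / ((n : ℝ) + 1) = (l'' - l') / 2 * (c / ((n : ℝ) + 1)) := by
          rw [hδ]; ring
        have h15 : δ / ((n : ℝ) + 1) ≤ (l'' - l') / 2 * a n := by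
          rw [h14]; exact mul_le_mul_of_nonneg_left h13 (by linarith)
        have h16 : 0 ≤ δ / ((n : ℝ) + 1) := by positivity
        nlinarith [mul_le_mul_of_nonneg_left h10.le h16]
      rw [div_le_iff₀ hΘn1]
      have hr : max (f n - e * Θ n) 0 / Θ n * Θ n = max (f n - e * Θ n) 0 :=
        div_mul_cancel₀ _ hΘn.ne'
      have h0δ : 0 ≤ 1 - δ / ((n : ℝ) + 1) := by
        by_contra hneg
        have := mul_neg_of_neg_of_pos (not_le.1 hneg) hl''pos
        linarith
      calc max (f (n + 1) - e * Θ (n + 1)) 0 ≤ (1 + l' * a n) * max (f n - e * Θ n) 0 := hg'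
        _ ≤ (1 - δ / ((n : ℝ) + 1)) * (1 + l'' * a n) * max (f n - e * Θ n) 0 :=
          mul_le_mul_of_nonneg_right hfac hG
        _ = (1 - δ / ((n : ℝ) + 1)) * (max (f n - e * Θ n) 0 / Θ n)
            * ((1 + l'' * a n) * Θ n) := by
          rw [← hr]; field_simp
        _ ≤ _ := mul_le_mul_of_nonneg_left hΘ'
          (mul_nonneg h0δ (div_nonneg hG hΘn.le))
  refine Metric.tendsto_atTop'.2 fun e he => ?_
  have h1 := (key (e / 2) (by positivity)).eventually_lt_const (u := e / 2) (by positivity)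
  obtain ⟨N, hN⟩ := eventually_atTop.1 ((h1.and hΘc).and hpos)
  refine ⟨N, fun n hn => ?_⟩
  obtain ⟨⟨h2, h3⟩, h4⟩ := hN n hn.le
  have hn' : (0 : ℝ) < n := by exact_mod_cast h4
  have hΘn : 0 < Θ n := (by positivity : 0 < c * (n : ℝ)).trans_le h3
  rw [Real.dist_eq, sub_zero, abs_of_nonneg (div_nonneg (hf0 n) hΘn.le), div_lt_iff₀ hΘn]
  rw [div_lt_iff₀ hΘn] at h2
  linarith [le_max_left (f n - e / 2 * Θ n) 0]

/-- If `φ` grows along the weights `a` with rate `z` and `ψ`, of exact linear order, with rate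
`l > re z`, then `φ` is of smaller than linear order. -/
theorem isLittleO_of_recursion {φ : ℕ → ℂ} {ψ a : ℕ → ℝ} {z : ℂ} {l c : ℝ}
    (hz : z.re < l) (hc : 0 < c)
    (hφ : (fun n => φ n - z * ∑ m ∈ Finset.range n, (a m : ℂ) * φ m) =o[atTop]
      fun n : ℕ => (n : ℝ))
    (hψ : (fun n => ψ n - l * ∑ m ∈ Finset.range n, a m * ψ m) =o[atTop] fun n : ℕ => (n : ℝ))
    (hψc : ∀ᶠ n : ℕ in atTop, c * n ≤ ψ n) (hψO : ψ =O[atTop] fun n : ℕ => (n : ℝ))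
    (hac : ∀ᶠ n : ℕ in atTop, c / n ≤ a n) (haO : a =O[atTop] fun n : ℕ => (n : ℝ)⁻¹) :
    φ =o[atTop] fun n : ℕ => (n : ℝ) := by
  -- Unlike `φ` and `ψ`, the sums `θ` and `Θ` have one-step recursions; the differences are `o(n)`
  -- and enter only multiplied by `a n = O(1 / n)`.
  set θ : ℕ → ℂ := fun n => z * ∑ m ∈ Finset.range n, (a m : ℂ) * φ m with hθ
  set Θ : ℕ → ℝ := fun n => l * ∑ m ∈ Finset.range n, a m * ψ m with hΘ
  have hpos : ∀ᶠ n : ℕ in atTop, 0 < n := eventually_gt_atTop 0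
  have hinv : ∀ {E : Type} [NormedAddCommGroup E] {g : ℕ → E},
      g =o[atTop] (fun n : ℕ => (n : ℝ)) → Tendsto (fun n => a n * ‖g n‖) atTop (𝓝 0) := by
    intro E _ g hg
    have h1 := haO.mul_isLittleO hg.norm_left
    refine (isLittleO_one_iff ℝ).1 (h1.congr' EventuallyEq.rfl ?_)
    filter_upwards [hpos] with n hn
    have : (n : ℝ) ≠ 0 := by positivity
    simp [this]
  have ha : Tendsto a atTop (𝓝 0) :=
    haO.trans_tendsto tendsto_inv_atTop_nhds_zero_nat
  set l' := (z.re + l) / 2 with hl'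
  have hη : Tendsto (fun n => ‖z‖ * (a n * ‖φ n - θ n‖) + |l| * (a n * ‖ψ n - Θ n‖))
      atTop (𝓝 0) := by
    simpa using ((hinv hφ).const_mul ‖z‖).add ((hinv hψ).const_mul |l|)
  have hapos : ∀ᶠ n in atTop, 0 < a n := by
    filter_upwards [hac, hpos] with n h1 h2
    have : (0 : ℝ) < n := by exact_mod_cast h2
    exact (by positivity : 0 < c / (n : ℝ)).trans_le h1
  have hΘO : Θ =O[atTop] fun n : ℕ => (n : ℝ) :=
    (hψO.sub hψ.isBigO).congr_left fun n => by ring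
  have hΘc : ∀ᶠ n : ℕ in atTop, c / 2 * n ≤ Θ n := by
    filter_upwards [hψc, hψ.bound (half_pos hc)] with n h1 h2
    simp only [Real.norm_eq_abs, Nat.abs_cast] at h2
    have := (abs_le.1 h2).2
    change ψ n - Θ n ≤ _ at this
    linarith
  have hratio : Tendsto (fun n => ‖θ n‖ / Θ n) atTop (𝓝 0) := by
    refine tendsto_div_of_recursion (l' := l') (l := l) (by rw [hl']; linarith) (half_pos hc)
      (fun n => norm_nonneg _) ?_ ?_ hΘc ?_ ha hη
    · have h1 : ∀ᶠ n in atTop, a n * ‖z‖ ^ 2 < 2 * (l' - z.re) := by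
        have : Tendsto (fun n => a n * ‖z‖ ^ 2) atTop (𝓝 0) := by simpa using ha.mul_const (‖z‖ ^ 2)
        exact this.eventually_lt_const (by rw [hl']; linarith)
      have h2 : ∀ᶠ n in atTop, 0 < 1 + l' * a n := by
        have : Tendsto (fun n => 1 + l' * a n) atTop (𝓝 1) := by
          simpa using (ha.const_mul l').const_add 1
        exact this.eventually_const_lt (by norm_num)
      filter_upwards [h1, h2, hapos] with n h3 h4 h5
      have h6 : θ (n + 1) = (1 + z * a n) * θ n + z * (a n * (φ n - θ n)) := by
        simp only [hθ, Finset.sum_range_succ]; ring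
      -- The square of the left side is `1 + 2 * re z * a n + ‖z‖ ^ 2 * a n ^ 2`; since `a n → 0`,
      -- raising the rate from `re z` to `l'` covers the quadratic term.
      have h7 : ‖1 + z * (a n : ℂ)‖ ≤ 1 + l' * a n := by
        refine le_of_sq_le_sq ?_ h4.le
        rw [Complex.sq_norm, Complex.normSq_apply]
        have h8 : ‖z‖ ^ 2 = z.re * z.re + z.im * z.im := by
          rw [Complex.sq_norm, Complex.normSq_apply]
        simp only [Complex.add_re, Complex.one_re, Complex.mul_re, Complex.ofReal_re,
          Complex.ofReal_im, Complex.add_im, Complex.one_im, Complex.mul_im]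
        have h10 := mul_le_mul_of_nonneg_left h3.le h5.le
        rw [h8] at h10
        linarith [sq_nonneg (l' * a n)]
      have h9 : ‖z * ((a n : ℂ) * (φ n - θ n))‖ = ‖z‖ * (a n * ‖φ n - θ n‖) := by
        rw [norm_mul, norm_mul, Complex.norm_real, Real.norm_of_nonneg h5.le]
      calc ‖θ (n + 1)‖ ≤ ‖1 + z * (a n : ℂ)‖ * ‖θ n‖ + ‖z * ((a n : ℂ) * (φ n - θ n))‖ := by
            rw [h6, ← norm_mul]; exact norm_add_le _ _
        _ ≤ (1 + l' * a n) * ‖θ n‖ + ‖z‖ * (a n * ‖φ n - θ n‖) := by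
            rw [h9]; gcongr
        _ ≤ _ := by
            have : 0 ≤ |l| * (a n * ‖ψ n - Θ n‖) := by positivity
            linarith
    · filter_upwards [hapos] with n h5
      have h6 : Θ (n + 1) = (1 + l * a n) * Θ n + l * (a n * (ψ n - Θ n)) := by
        simp only [hΘ, Finset.sum_range_succ]; ring
      have h7 : |l * (a n * (ψ n - Θ n))| = |l| * (a n * ‖ψ n - Θ n‖) := by
        rw [abs_mul, abs_mul, abs_of_pos h5, Real.norm_eq_abs]
      have h8 := neg_abs_le (l * (a n * (ψ n - Θ n)))
      have : 0 ≤ ‖z‖ * (a n * ‖φ n - θ n‖) := by positivity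
      rw [h6]
      linarith
    · filter_upwards [hac] with n h1
      refine le_trans ?_ h1
      gcongr
      linarith
  have hθo : θ =o[atTop] fun n : ℕ => (n : ℝ) := by
    have h1 : (fun n => ‖θ n‖ / Θ n * Θ n) =o[atTop] fun n : ℕ => (1 : ℝ) * n :=
      ((isLittleO_one_iff ℝ).2 hratio).mul_isBigO hΘO
    refine (h1.congr' ?_ (by simp)).of_norm_left
    filter_upwards [hΘc, hpos] with n h2 h3
    have hn : (0 : ℝ) < n := by exact_mod_cast h3
    exact div_mul_cancel₀ _ ((by positivity : 0 < c / 2 * (n : ℝ)).trans_le h2).ne'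
  exact (hφ.add hθo).congr_left fun n => by ring

/-- A sequence whose drift is nonnegative below zero has a negligible negative part. -/
theorem isLittleO_max_zero_sub {y w : ℕ → ℝ} {C : ℝ}
    (hyw : (fun n => y n - w n) =o[atTop] fun n : ℕ => (n : ℝ))
    (hC : ∀ n, w n - C ≤ w (n + 1)) (hneg : ∀ᶠ n in atTop, y n < 0 → w n ≤ w (n + 1)) :
    (fun n => max (y n) 0 - y n) =o[atTop] fun n : ℕ => (n : ℝ) := by
  refine isLittleO_iff.2 fun e he => ?_
  obtain ⟨N, hN⟩ := eventually_atTop.1 (hneg.and (hyw.bound (show 0 < e / 3 by positivity)))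
  -- The bound persists because `w` can decrease only when `y n ≥ 0`; then `w n ≥ -(e / 3) * n`, and
  -- one step loses at most `C`.
  have key : ∀ n, N ≤ n → -(|w N| + |C| + e / 3 * n) ≤ w n := by
    intro n hn
    induction n, hn using Nat.le_induction with
    | base =>
      have : 0 ≤ e / 3 * (N : ℝ) := by positivity
      linarith [neg_abs_le (w N), abs_nonneg C]
    | succ n hn ih =>
      obtain ⟨h1, h2⟩ := hN n hn
      push_cast
      by_cases hy : y n < 0
      · linarith [h1 hy]
      · simp only [Real.norm_eq_abs, Nat.abs_cast] at h2
        linarith [hC n, (abs_le.1 h2).2, le_abs_self C, abs_nonneg (w N)]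
  have hlarge : ∀ᶠ n : ℕ in atTop, |w N| + |C| ≤ e / 3 * n := by
    have : Tendsto (fun n : ℕ => e / 3 * (n : ℝ)) atTop atTop :=
      tendsto_natCast_atTop_atTop.const_mul_atTop (by positivity)
    exact this.eventually_ge_atTop _
  filter_upwards [hlarge, eventually_ge_atTop N] with n h1 h2
  have h3 := (hN n h2).2
  simp only [Real.norm_eq_abs, Nat.abs_cast] at h3 ⊢
  rw [abs_of_nonneg (sub_nonneg.2 (le_max_left _ _))]
  have h4 := key n h2
  have h5 := (abs_le.1 h3).1
  have h6 : 0 ≤ e * (n : ℝ) := by positivity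
  rcases max_cases (y n) 0 with ⟨h, _⟩ | ⟨h, _⟩ <;> rw [h] <;> linarith

end Recursion

/-! ### Deterministic analysis of one path. -/

section Dynamics

variable {d : ℕ}

theorem posVec_nonneg (y : Fin d → ℝ) (k : Fin d) : 0 ≤ posVec y k := le_max_right _ _

theorem composition_mem_stdSimplex {p : Fin d → ℝ} (hp : p ∈ stdSimplex ℝ (Fin d))
    (y : Fin d → ℝ) : composition p y ∈ stdSimplex ℝ (Fin d) := by
  by_cases h : ∑ j, posVec y j = 0
  · have : composition p y = p := by ext k; simp [composition, h]
    rwa [this]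
  · refine ⟨fun k => ?_, ?_⟩
    · simp only [composition, h, if_false]
      exact div_nonneg (posVec_nonneg y k) (Finset.sum_nonneg fun j _ => posVec_nonneg y j)
    · simp only [composition, h, if_false]
      rw [← Finset.sum_div, div_self h]

theorem composition_of_pos {p y : Fin d → ℝ} (h : 0 < ∑ j, posVec y j) :
    composition p y = (∑ j, posVec y j)⁻¹ • posVec y := by
  ext k
  simp [composition, h.ne', div_eq_inv_mul]

/-- Right multiplication of row vectors by a matrix, as a continuous linear map. -/
noncomputable def vecMulCLM (H : Matrix (Fin d) (Fin d) ℝ) : (Fin d → ℝ) →L[ℝ] (Fin d → ℝ) :=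
  LinearMap.toContinuousLinearMap H.vecMulLinear

@[simp] theorem vecMulCLM_apply (H : Matrix (Fin d) (Fin d) ℝ) (x : Fin d → ℝ) :
    vecMulCLM H x = x ᵥ* H := rfl

/-- The pairing of a real row vector with a complex column vector. -/
noncomputable def pairing (h : Fin d → ℂ) : (Fin d → ℝ) →L[ℝ] ℂ :=
  ∑ k, (ContinuousLinearMap.proj (R := ℝ) k).smulRight (h k)

theorem pairing_apply (h : Fin d → ℂ) (x : Fin d → ℝ) : pairing h x = ∑ k, (x k : ℂ) * h k := by
  simp [pairing]

theorem pairing_sub_smul (z : ℂ) (g h : Fin d → ℂ) (x : Fin d → ℝ) :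
    pairing (g - z • h) x = pairing g x - z * pairing h x := by
  simp only [pairing_apply, Finset.mul_sum, ← Finset.sum_sub_distrib]
  refine Finset.sum_congr rfl fun k _ => ?_
  simp only [Pi.sub_apply, Pi.smul_apply, smul_eq_mul]
  ring

/-- Moves `H` onto the column vector, so that eigenvectors turn the vector recursion into scalar
ones. -/
theorem pairing_vecMul (H : Matrix (Fin d) (Fin d) ℝ) (h : Fin d → ℂ) (x : Fin d → ℝ) :
    pairing h (x ᵥ* H) = pairing (H.map (algebraMap ℝ ℂ) *ᵥ h) x := by
  simp only [pairing_apply, Matrix.vecMul, Matrix.mulVec, dotProduct, Complex.ofReal_sum,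
    Finset.sum_mul, Finset.mul_sum]
  rw [Finset.sum_comm]
  refine Finset.sum_congr rfl fun i _ => Finset.sum_congr rfl fun j _ => ?_
  simp [mul_assoc]

theorem isLittleO_clm {E F : Type*} [NormedAddCommGroup E] [NormedSpace ℝ E]
    [NormedAddCommGroup F] [NormedSpace ℝ F] (L : E →L[ℝ] F) {f : ℕ → E} {g : ℕ → ℝ}
    (hf : f =o[atTop] g) : (fun n => L (f n)) =o[atTop] g :=
  (L.isBigO_comp f atTop).trans_isLittleO hf

/-- The column vectors whose pairing with the sequence `Y` is of smaller than linear order. -/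
noncomputable def negligible (Y : ℕ → Fin d → ℝ) : Submodule ℂ (Fin d → ℂ) where
  carrier := {h | (fun n => pairing h (Y n)) =o[atTop] fun n : ℕ => (n : ℝ)}
  zero_mem' := by
    have : (fun n => pairing 0 (Y n)) = fun _ => (0 : ℂ) := by ext n; simp [pairing_apply]
    simp only [Set.mem_ofPred_eq, this]
    exact isLittleO_zero _ _
  add_mem' {a b} ha hb := (ha.add hb).congr_left fun n => by
    simp [pairing_apply, mul_add, Finset.sum_add_distrib]
  smul_mem' c h hh := (hh.const_mul_left c).congr_left fun n => by
    simp only [pairing_apply, Finset.mul_sum, Pi.smul_apply, smul_eq_mul]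
    exact Finset.sum_congr rfl fun k _ => by ring

theorem mem_negligible {Y : ℕ → Fin d → ℝ} {h : Fin d → ℂ} :
    h ∈ negligible Y ↔ (fun n => pairing h (Y n)) =o[atTop] fun n : ℕ => (n : ℝ) := Iff.rfl

theorem isLittleO_pi_iff {f : ℕ → Fin d → ℝ} {g : ℕ → ℝ} :
    f =o[atTop] g ↔ ∀ k, (fun n => f n k) =o[atTop] g := isLittleO_pi

/-- The consequences of the approximate recursion for a sequence of urn compositions `Y` with
draw counts `N`. -/
theorem urn_asymptotics {H : Matrix (Fin d) (Fin d) ℝ} {u : Fin d → ℝ} {l : ℝ} {p : Fin d → ℝ}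
    (hoff : ∀ q k, q ≠ k → 0 ≤ H q k) (hu : ∀ k, 0 < u k) (hHu : H *ᵥ u = l • u) (hl : 0 < l)
    (hp : p ∈ stdSimplex ℝ (Fin d)) {Y N : ℕ → Fin d → ℝ}
    (hY : (fun n => Y n - N n ᵥ* H) =o[atTop] fun n : ℕ => (n : ℝ))
    (hN : (fun n => N n - ∑ m ∈ Finset.range n, composition p (Y m)) =o[atTop]
      fun n : ℕ => (n : ℝ))
    (hN0 : ∀ n k, 0 ≤ N n k) (hN1 : ∀ n, ∑ k, N n k = n) :
    Tendsto (fun n => composition p (Y n) ᵥ* H - l • composition p (Y n)) atTop (𝓝 0) ∧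
    (fun n => N n ᵥ* H - l • N n) =o[atTop] (fun n : ℕ => (n : ℝ)) ∧
    (fun n => Y n - l • N n) =o[atTop] (fun n : ℕ => (n : ℝ)) ∧
    (fun n => posVec (Y n) - Y n) =o[atTop] (fun n : ℕ => (n : ℝ)) ∧
    ∀ᶠ n in atTop, 0 < ∑ k, posVec (Y n) k := by
  have : Nonempty (Fin d) := by
    by_contra h
    have : ∑ k, p k = 0 := by
      rw [not_nonempty_iff] at h
      exact Finset.sum_of_isEmpty _
    rw [hp.2] at this
    exact one_ne_zero this
  have hpos : ∀ᶠ n : ℕ in atTop, 0 < n := eventually_gt_atTop 0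
  have hNO : N =O[atTop] fun n : ℕ => (n : ℝ) := IsBigO.of_bound 1 <| Eventually.of_forall fun n => by
    rw [one_mul, Real.norm_natCast, pi_norm_le_iff_of_nonneg (Nat.cast_nonneg n)]
    intro k
    rw [Real.norm_of_nonneg (hN0 n k), ← hN1 n]
    exact Finset.single_le_sum (f := N n) (fun q _ => hN0 n q) (Finset.mem_univ k)
  have hYO : Y =O[atTop] fun n : ℕ => (n : ℝ) :=
    (hY.isBigO.add (((vecMulCLM H).isBigO_comp N atTop).trans hNO)).congr_left fun n => by simp
  -- the total mass is of exact linear order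
  set uR : (Fin d → ℝ) →L[ℝ] ℝ := ∑ k, u k • ContinuousLinearMap.proj (R := ℝ) k with huR
  have huR_apply : ∀ x, uR x = ∑ k, x k * u k := fun x => by simp [huR, mul_comm]
  have huR_vecMul : ∀ x, uR (x ᵥ* H) = l * uR x := fun x => by
    have h1 : (x ᵥ* H) ⬝ᵥ u = x ⬝ᵥ (H *ᵥ u) := (Matrix.dotProduct_mulVec x H u).symm
    rw [hHu, dotProduct_smul, smul_eq_mul] at h1
    simpa [huR_apply, dotProduct] using h1
  obtain ⟨k₀, hk₀⟩ := Finite.exists_min u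
  obtain ⟨k₁, hk₁⟩ := Finite.exists_max u
  have hYu : (fun n => uR (Y n) - l * uR (N n)) =o[atTop] fun n : ℕ => (n : ℝ) :=
    (isLittleO_clm uR hY).congr_left fun n => by rw [map_sub, huR_vecMul]
  have hNu : ∀ n, u k₀ * n ≤ uR (N n) := fun n => by
    rw [huR_apply, ← hN1 n, Finset.mul_sum]
    refine Finset.sum_le_sum fun k _ => ?_
    rw [mul_comm]
    exact mul_le_mul_of_nonneg_left (hk₀ k) (hN0 n k)
  -- Half of the true lower slope; the other half absorbs the `o(n)` error.
  set c₁ := l * u k₀ / 2 with hc₁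
  have hc₁pos : 0 < c₁ := by have := hu k₀; positivity
  have hYuc : ∀ᶠ n : ℕ in atTop, c₁ * n ≤ uR (Y n) := by
    filter_upwards [hYu.bound hc₁pos] with n h1
    simp only [Real.norm_eq_abs, Nat.abs_cast] at h1
    have h2 := (abs_le.1 h1).1
    have h3 := mul_le_mul_of_nonneg_left (hNu n) hl.le
    have h4 : l * (u k₀ * n) = 2 * (c₁ * n) := by rw [hc₁]; ring
    linarith
  set s : ℕ → ℝ := fun n => ∑ k, posVec (Y n) k with hs
  have hYs : ∀ n, uR (Y n) ≤ s n * u k₁ := fun n => by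
    rw [huR_apply, hs, Finset.sum_mul]
    refine Finset.sum_le_sum fun k _ => ?_
    exact (mul_le_mul_of_nonneg_right (le_max_left _ _) (hu k).le).trans
      (mul_le_mul_of_nonneg_left (hk₁ k) (posVec_nonneg _ k))
  set c₂ := c₁ / u k₁ with hc₂
  have hc₂pos : 0 < c₂ := div_pos hc₁pos (hu k₁)
  have hsc : ∀ᶠ n : ℕ in atTop, c₂ * n ≤ s n := by
    filter_upwards [hYuc] with n h1
    have h2 := h1.trans (hYs n)
    rw [hc₂, div_mul_eq_mul_div, div_le_iff₀ (hu k₁)]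
    exact h2
  have hspos : ∀ᶠ n in atTop, 0 < s n := by
    filter_upwards [hsc, hpos] with n h1 h2
    have : (0 : ℝ) < n := by exact_mod_cast h2
    exact (by positivity : 0 < c₂ * (n : ℝ)).trans_le h1
  -- the negative part is negligible
  have hZ : (fun n => Y n - (∑ m ∈ Finset.range n, composition p (Y m)) ᵥ* H) =o[atTop]
      fun n : ℕ => (n : ℝ) :=
    (hY.add (isLittleO_clm (vecMulCLM H) hN)).congr_left fun n => by
      rw [vecMulCLM_apply, Matrix.sub_vecMul]; abel
  have hneg : (fun n => posVec (Y n) - Y n) =o[atTop] fun n : ℕ => (n : ℝ) := by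
    refine isLittleO_pi_iff.2 fun k => ?_
    have hstep : ∀ n, ((∑ m ∈ Finset.range (n + 1), composition p (Y m)) ᵥ* H) k
        = ((∑ m ∈ Finset.range n, composition p (Y m)) ᵥ* H) k
          + ∑ q, composition p (Y n) q * H q k := fun n => by
      rw [Finset.sum_range_succ, Matrix.add_vecMul, Pi.add_apply]
      rfl
    refine isLittleO_max_zero_sub (C := ∑ q, |H q k|) (isLittleO_pi_iff.1 hZ k) (fun n => ?_) ?_
    · rw [hstep]
      have h1 : -∑ q, |H q k| ≤ ∑ q, composition p (Y n) q * H q k := by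
        rw [← Finset.sum_neg_distrib]
        refine Finset.sum_le_sum fun q _ => ?_
        have h2 := composition_mem_stdSimplex hp (Y n)
        have h3 : composition p (Y n) q ≤ 1 := by
          rw [← h2.2]
          exact Finset.single_le_sum (f := composition p (Y n)) (fun q _ => h2.1 q)
            (Finset.mem_univ q)
        have h4 := mul_le_mul_of_nonneg_left (neg_abs_le (H q k)) (h2.1 q)
        have h5 := mul_le_mul_of_nonneg_right h3 (abs_nonneg (H q k))
        linarith
      linarith
    · filter_upwards [hspos] with n h1 h2
      rw [hstep]
      have h3 : 0 ≤ ∑ q, composition p (Y n) q * H q k := by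
        refine Finset.sum_nonneg fun q _ => ?_
        by_cases hq : q = k
        -- A negative coordinate has selection probability zero, so the possibly negative diagonal
        -- entry does not contribute to the drift.
        · have h4 : composition p (Y n) q = 0 := by
            rw [composition_of_pos h1, hq]
            simp [posVec, h2.le]
          simp [h4]
        · exact mul_nonneg ((composition_mem_stdSimplex hp (Y n)).1 q) (hoff q k hq)
      linarith
  -- the composition is asymptotically a multiple of `Y`
  set a : ℕ → ℝ := fun n => (s n)⁻¹ with ha
  have haO : a =O[atTop] fun n : ℕ => (n : ℝ)⁻¹ := by
    refine IsBigO.of_bound c₂⁻¹ ?_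
    filter_upwards [hsc, hpos] with n h1 h2
    have hn : (0 : ℝ) < n := by exact_mod_cast h2
    have h3 : 0 < c₂ * n := by positivity
    rw [Real.norm_of_nonneg (inv_nonneg.2 (h3.le.trans h1)),
      Real.norm_of_nonneg (inv_nonneg.2 hn.le), ← mul_inv]
    exact inv_anti₀ h3 h1
  have ha_smul : ∀ {E : Type} [NormedAddCommGroup E] [NormedSpace ℝ E] {g : ℕ → E},
      g =o[atTop] (fun n : ℕ => (n : ℝ)) → Tendsto (fun n => a n • g n) atTop (𝓝 0) := by
    intro E _ _ g hg
    refine (isLittleO_one_iff ℝ).1 ((haO.smul_isLittleO hg).congr' EventuallyEq.rfl ?_)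
    filter_upwards [hpos] with n hn
    have : (n : ℝ) ≠ 0 := by positivity
    simp [this]
  have hδ : Tendsto (fun n => composition p (Y n) - a n • Y n) atTop (𝓝 0) := by
    refine (ha_smul hneg).congr' ?_
    filter_upwards [hspos] with n h1
    rw [composition_of_pos h1, smul_sub]
  obtain ⟨c₃, hc₃pos, hc₃⟩ : ∃ c₃ > 0, ∀ᶠ n : ℕ in atTop, c₃ / n ≤ a n := by
    obtain ⟨C, hC, hYC⟩ := hYO.exists_pos
    refine ⟨(d * C)⁻¹, ?_, ?_⟩
    · have : 0 < d := Fin.pos k₀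
      positivity
    · filter_upwards [hYC.bound, hspos] with n h1 h2
      have h3 : s n ≤ d * C * n := by
        have h4 : ∀ k, posVec (Y n) k ≤ C * n := fun k => by
          rw [Real.norm_natCast] at h1
          refine max_le ((le_abs_self _).trans ((norm_le_pi_norm (Y n) k).trans h1)) ?_
          positivity
        refine (Finset.sum_le_sum fun k _ => h4 k).trans (le_of_eq ?_)
        simp [mul_assoc]
      rw [div_eq_mul_inv, ← mul_inv]
      exact inv_anti₀ h2 h3
  -- Each composition is `a m • Y m` up to `o(1)`, and such errors sum to `o(n)`.
  have hV : (fun n => Y n - (∑ m ∈ Finset.range n, a m • Y m) ᵥ* H) =o[atTop]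
      fun n : ℕ => (n : ℝ) :=
    (hZ.add (isLittleO_clm (vecMulCLM H) (isLittleO_sum_range_of_tendsto_zero hδ))).congr_left
      fun n => by
        rw [vecMulCLM_apply, Finset.sum_sub_distrib, Matrix.sub_vecMul]; abel
  -- spectral decomposition
  have hspec : ∀ h : Fin d → ℂ, H.map (algebraMap ℝ ℂ) *ᵥ h - (l : ℂ) • h ∈ negligible Y := by
    refine mulVec_sub_smul_mem hoff hu hHu _ fun z h hz hg => ?_
    rw [mem_negligible] at hg ⊢
    refine isLittleO_of_recursion (φ := fun n => pairing h (Y n)) (ψ := fun n => uR (Y n)) (a := a)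
      (l := l) (c := min c₁ c₃) hz (lt_min hc₁pos hc₃pos) ?_ ?_ ?_
      ((uR.isBigO_comp Y atTop).trans hYO) ?_ haO
    · have h1 := isLittleO_clm (pairing h) hV
      -- `h` need not be an eigenvector: the pairing with `(H - z) h` is already `o(n)`, so with
      -- weights `a m` it sums to `o(n)` and acts as a further error term.
      have h2 := isLittleO_sum_range_of_tendsto_zero (ha_smul hg)
      refine (h1.add h2).congr_left fun n => ?_
      rw [map_sub, pairing_vecMul, map_sum, Finset.mul_sum, sub_add, ← Finset.sum_sub_distrib]
      congr 1
      refine Finset.sum_congr rfl fun m _ => ?_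
      rw [map_smul, pairing_sub_smul, Complex.real_smul, Complex.real_smul]
      ring
    · refine (isLittleO_clm uR hV).congr_left fun n => ?_
      rw [map_sub, huR_vecMul, map_sum]
      simp
    · filter_upwards [hYuc] with n h1
      exact (mul_le_mul_of_nonneg_right (min_le_left _ _) (Nat.cast_nonneg n)).trans h1
    · filter_upwards [hc₃] with n h1
      exact (div_le_div_of_nonneg_right (min_le_right _ _) (Nat.cast_nonneg n)).trans h1
  have hR : (fun n => Y n ᵥ* H - l • Y n) =o[atTop] fun n : ℕ => (n : ℝ) := by
    refine isLittleO_pi_iff.2 fun k => ?_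
    -- Pairing with `(H - l)` applied to the `k`-th unit column gives the `k`-th coordinate of `Y n
    -- * (H - l)`.
    refine (isLittleO_clm Complex.reCLM (mem_negligible.1 (hspec (Pi.single k 1)))).congr_left
      fun n => ?_
    rw [pairing_sub_smul, ← pairing_vecMul]
    simp [pairing_apply, Pi.single_apply]
  set R := vecMulCLM H - l • ContinuousLinearMap.id ℝ (Fin d → ℝ) with hRdef
  have hRapp : ∀ x, R x = x ᵥ* H - l • x := fun x => rfl
  have hRcont : Tendsto R (𝓝 0) (𝓝 0) := by
    have := R.continuous.tendsto 0
    rwa [map_zero] at this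
  have hA : Tendsto (fun n => composition p (Y n) ᵥ* H - l • composition p (Y n)) atTop (𝓝 0) := by
    have h3 := (ha_smul hR).add (hRcont.comp hδ)
    rw [add_zero] at h3
    refine h3.congr fun n => ?_
    rw [Function.comp_apply, map_sub, map_smul, hRapp, hRapp]
    abel
  have hB : (fun n => N n ᵥ* H - l • N n) =o[atTop] fun n : ℕ => (n : ℝ) := by
    refine ((isLittleO_sum_range_of_tendsto_zero hA).add (isLittleO_clm R hN)).congr_left
      fun n => ?_
    rw [map_sub, map_sum]
    simp only [hRapp]
    abel
  exact ⟨hA, hB, (hY.add hB).congr_left fun n => by abel, hneg, hspos⟩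

/-- Points of a compact set at which a continuous function tends to zero approach its zero set. -/
theorem nonempty_and_tendsto_infDist {E F : Type*} [PseudoMetricSpace E] [TopologicalSpace F]
    [T2Space F] {K : Set E} (hK : IsCompact K) {g : E → F} (hg : Continuous g) {b : F} {x : ℕ → E}
    (hx : ∀ᶠ n in atTop, x n ∈ K) (hgx : Tendsto (fun n => g (x n)) atTop (𝓝 b)) :
    {y | y ∈ K ∧ g y = b}.Nonempty ∧
      Tendsto (fun n => Metric.infDist (x n) {y | y ∈ K ∧ g y = b}) atTop (𝓝 0) := by
  -- By compactness each subsequence has a convergent further subsequence, and continuity puts its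
  -- limit in the fibre over `b`.
  have key : ∀ ns : ℕ → ℕ, Tendsto ns atTop atTop → ∃ y ∈ {y | y ∈ K ∧ g y = b}, ∃ ms : ℕ → ℕ,
      Tendsto (fun n => x (ns (ms n))) atTop (𝓝 y) := by
    intro ns hns
    obtain ⟨y, hy, ms, hms, hlim⟩ := hK.tendsto_subseq' (hns.eventually hx).frequently
    refine ⟨y, ⟨hy, ?_⟩, ms, hlim⟩
    exact tendsto_nhds_unique ((hg.tendsto y).comp hlim)
      (hgx.comp (hns.comp hms.tendsto_atTop))
  refine ⟨?_, tendsto_of_subseq_tendsto fun ns hns => ?_⟩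
  · obtain ⟨y, hy, -⟩ := key id tendsto_id
    exact ⟨y, hy⟩
  · obtain ⟨y, hy, ms, hlim⟩ := key ns hns
    refine ⟨ms, ?_⟩
    have := ((Metric.continuous_infDist_pt {y | y ∈ K ∧ g y = b}).tendsto y).comp hlim
    rwa [Metric.infDist_zero_of_mem hy] at this

end Dynamics

theorem sum_Icc_one {E : Type*} [AddCommMonoid E] (f : ℕ → E) (n : ℕ) :
    ∑ m ∈ Finset.Icc 1 n, f m = ∑ m ∈ Finset.range n, f (m + 1) := by
  induction n with
  | zero => simp
  | succ n ih => rw [Finset.sum_Icc_succ_top (by omega), ih, Finset.sum_range_succ]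

/-! ### From approximate eigenvectors to distances from `leftSimplex H`. -/

section Path

variable {d : ℕ}

theorem tendsto_inv_smul {E : Type*} [NormedAddCommGroup E] [NormedSpace ℝ E] {f : ℕ → E}
    (hf : f =o[atTop] fun n : ℕ => (n : ℝ)) :
    Tendsto (fun n : ℕ => (n : ℝ)⁻¹ • f n) atTop (𝓝 0) := by
  refine (isLittleO_one_iff ℝ).1 (((isBigO_refl (fun n : ℕ => (n : ℝ)⁻¹) atTop).smul_isLittleO
    hf).congr' EventuallyEq.rfl ?_)
  filter_upwards [eventually_gt_atTop 0] with n hn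
  have : (n : ℝ) ≠ 0 := by positivity
  simp [this]

theorem tendsto_infDist_of_tendsto_sub {E : Type*} [NormedAddCommGroup E] {S : Set E} {x y : ℕ → E}
    (hx : Tendsto (fun n => Metric.infDist (x n) S) atTop (𝓝 0))
    (hxy : Tendsto (fun n => y n - x n) atTop (𝓝 0)) :
    Tendsto (fun n => Metric.infDist (y n) S) atTop (𝓝 0) := by
  have h := hx.add (tendsto_zero_iff_norm_tendsto_zero.1 hxy)
  rw [add_zero] at h
  refine squeeze_zero (fun n => Metric.infDist_nonneg) (fun n => ?_) h
  rw [← dist_eq_norm]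
  exact Metric.infDist_le_infDist_add_dist

/-- The limit behaviour of a path of the urn along which the random errors are negligible. -/
theorem path_limits {H : Matrix (Fin d) (Fin d) ℝ} {p : Fin d → ℝ} (hH : Admissible H)
    (hp : p ∈ stdSimplex ℝ (Fin d)) {Y N : ℕ → Fin d → ℝ}
    (hY : (fun n => Y n - N n ᵥ* H) =o[atTop] fun n : ℕ => (n : ℝ))
    (hN : (fun n => N n - ∑ m ∈ Finset.range n, composition p (Y m)) =o[atTop]
      fun n : ℕ => (n : ℝ))
    (hN0 : ∀ n k, 0 ≤ N n k) (hN1 : ∀ n, ∑ k, N n k = n) :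
    (leftSimplex H).Nonempty ∧
      Tendsto (fun n : ℕ => Metric.infDist ((n : ℝ)⁻¹ • Y n) (lam H • leftSimplex H))
        atTop (𝓝 0) ∧
      Tendsto (fun n : ℕ => Metric.infDist ((n : ℝ)⁻¹ • posVec (Y n)) (lam H • leftSimplex H))
        atTop (𝓝 0) ∧
      Tendsto (fun n : ℕ => Metric.infDist (composition p (Y n)) (leftSimplex H)) atTop (𝓝 0) ∧
      Tendsto (fun n : ℕ => Metric.infDist ((n : ℝ)⁻¹ • N n) (leftSimplex H)) atTop (𝓝 0) := by
  obtain ⟨u, hu, hHu⟩ := hH.exists_right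
  obtain ⟨hA, hB, hC, hD, -⟩ :=
    urn_asymptotics hH.offDiag_nonneg hu hHu hH.lam_pos hp hY hN hN0 hN1
  have hS : leftSimplex H = {y | y ∈ stdSimplex ℝ (Fin d) ∧ y ᵥ* H - lam H • y = 0} := by
    ext y
    simp [leftSimplex, sub_eq_zero]
  have hg : Continuous fun y : Fin d → ℝ => y ᵥ* H - lam H • y :=
    (vecMulCLM H).continuous.sub (continuous_const_smul _)
  have hK : IsCompact (stdSimplex ℝ (Fin d)) := isCompact_stdSimplex ℝ (Fin d)
  obtain ⟨hne, hcomp⟩ := nonempty_and_tendsto_infDist hK hg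
    (Eventually.of_forall fun n => composition_mem_stdSimplex hp (Y n)) hA
  have hNmem : ∀ᶠ n : ℕ in atTop, (n : ℝ)⁻¹ • N n ∈ stdSimplex ℝ (Fin d) := by
    filter_upwards [eventually_gt_atTop 0] with n hn
    have hn' : (n : ℝ) ≠ 0 := by positivity
    refine ⟨fun k => mul_nonneg (by positivity) (hN0 n k), ?_⟩
    simp only [Pi.smul_apply, smul_eq_mul]
    rw [← Finset.mul_sum, hN1, inv_mul_cancel₀ hn']
  obtain ⟨-, hNlim⟩ := nonempty_and_tendsto_infDist hK hg hNmem
    ((tendsto_inv_smul hB).congr fun n => by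
      rw [smul_sub, Matrix.smul_vecMul, smul_comm])
  rw [← hS] at hne hcomp hNlim
  have h1 : Tendsto (fun n : ℕ => Metric.infDist (lam H • (n : ℝ)⁻¹ • N n)
      (lam H • leftSimplex H)) atTop (𝓝 0) := by
    simp only [infDist_smul₀ hH.lam_pos.ne']
    simpa using hNlim.const_mul ‖lam H‖
  have h2 := tendsto_infDist_of_tendsto_sub (y := fun n : ℕ => (n : ℝ)⁻¹ • Y n) h1
    ((tendsto_inv_smul hC).congr fun n => by rw [smul_sub, smul_comm])
  have h3 := tendsto_infDist_of_tendsto_sub (y := fun n : ℕ => (n : ℝ)⁻¹ • posVec (Y n)) h2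
    ((tendsto_inv_smul hD).congr fun n => by rw [smul_sub])
  exact ⟨hne, h2, h3, hcomp, hNlim⟩

end Path

/-! ### Conditional independence for integrable functions. -/

section CondIndep

variable {Ω : Type*} {m m0 : MeasurableSpace Ω} {μ : Measure Ω}

theorem condExp_indicator_one_mem_Icc (A : Set Ω) :
    ∀ᵐ ω ∂μ, 0 ≤ (μ⟦A | m⟧) ω ∧ (μ⟦A | m⟧) ω ≤ 1 := by
  have h0 : 0 ≤ᵐ[μ] μ⟦A | m⟧ := condExp_nonneg (Eventually.of_forall fun ω =>
    Set.indicator_nonneg (fun _ _ => zero_le_one) ω)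
  have h1 : ∀ᵐ ω ∂μ, |(μ⟦A | m⟧) ω| ≤ 1 :=
    ae_bdd_abs_condExp_of_ae_bdd_abs (Eventually.of_forall fun ω => by
      by_cases h : ω ∈ A <;> simp [h])
  filter_upwards [h0, h1] with ω h2 h3
  exact ⟨h2, (abs_le.1 h3).2⟩

variable [IsProbabilityMeasure μ]

/-- If the event `A` and the random variable `D` are conditionally independent given `m`, then the
conditional expectation of `1_A g(D)` is a product. -/
theorem condExp_indicator_comp (hm : m ≤ m0) {A : Set Ω} (hA : MeasurableSet A) {β : Type*}
    [MeasurableSpace β] {D : Ω → β} (hD : Measurable D)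
    (hind : ∀ B, MeasurableSet B → μ⟦A ∩ D ⁻¹' B | m⟧ =ᵐ[μ] μ⟦A | m⟧ * μ⟦D ⁻¹' B | m⟧)
    {g : β → ℝ} (hg : Measurable g) (hint : Integrable (fun ω => g (D ω)) μ) :
    μ[A.indicator fun ω => g (D ω) | m] =ᵐ[μ] μ⟦A | m⟧ * μ[fun ω => g (D ω) | m] := by
  set P : Ω → ℝ := μ⟦A | m⟧ with hP
  have hPm : StronglyMeasurable[m] P := stronglyMeasurable_condExp
  have hPbd : ∀ᵐ ω ∂μ, 0 ≤ P ω ∧ P ω ≤ 1 := condExp_indicator_one_mem_Icc A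
  have hPnorm : ∀ᵐ ω ∂μ, ‖P ω‖ ≤ 1 := by
    filter_upwards [hPbd] with ω h
    rw [Real.norm_of_nonneg h.1]
    exact h.2
  have hPg : ∀ {f : Ω → ℝ}, Integrable f μ → Integrable (fun ω => P ω * f ω) μ := fun hf =>
    hf.bdd_mul (hPm.mono hm).aestronglyMeasurable hPnorm
  have hpull : ∀ {f : Ω → ℝ}, Integrable f μ →
      μ[fun ω => P ω * f ω | m] =ᵐ[μ] P * μ[f | m] := fun hf =>
    condExp_stronglyMeasurable_mul_of_bound hm hPm hf 1 hPnorm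
  refine EventuallyEq.trans ?_ (hpull hint)
  have hone : ∀ {B : Set Ω}, MeasurableSet B → Integrable (B.indicator fun _ => (1 : ℝ)) μ :=
    fun hB => (integrable_const 1).indicator hB
  have hset : ∀ S, MeasurableSet[m] S → ∫ ω in S, A.indicator (fun ω => g (D ω)) ω ∂μ
      = ∫ ω in S, P ω * g (D ω) ∂μ := by
    intro S hS
    have hS0 := hm S hS
    have hmeas : Measurable fun ω => ENNReal.ofReal (P ω) :=
      (hPm.mono hm).measurable.ennreal_ofReal
    -- Conditional independence, integrated over `S`, says that `D` has the same law under
    -- restriction to `A ∩ S` as under the density `P` on `S`; any integrand `g` can then be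
    -- transferred at once.
    have hν : (μ.restrict (A ∩ S)).map D
        = ((μ.restrict S).withDensity fun ω => ENNReal.ofReal (P ω)).map D := by
      ext B hB
      have hDB := hD hB
      rw [Measure.map_apply hD hB, Measure.map_apply hD hB, withDensity_apply _ hDB,
        Measure.restrict_apply hDB, Measure.restrict_restrict hDB]
      have h1 : ∫ ω in D ⁻¹' B ∩ S, P ω ∂μ = μ.real (D ⁻¹' B ∩ (A ∩ S)) := by
        calc ∫ ω in D ⁻¹' B ∩ S, P ω ∂μ
            = ∫ ω in S, P ω * (D ⁻¹' B).indicator (fun _ => (1 : ℝ)) ω ∂μ := by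
              rw [Set.inter_comm, ← setIntegral_indicator hDB]
              congr 1 with ω
              by_cases h : ω ∈ D ⁻¹' B <;> simp [h]
          _ = ∫ ω in S, (μ[fun ω => P ω * (D ⁻¹' B).indicator (fun _ => (1 : ℝ)) ω | m]) ω ∂μ :=
              (setIntegral_condExp hm (hPg (hone hDB)) hS).symm
          _ = ∫ ω in S, (μ⟦A ∩ D ⁻¹' B | m⟧) ω ∂μ :=
              integral_congr_ae (ae_restrict_of_ae ((hpull (hone hDB)).trans (hind B hB).symm))
          _ = ∫ ω in S, (A ∩ D ⁻¹' B).indicator (fun _ => (1 : ℝ)) ω ∂μ :=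
              setIntegral_condExp hm (hone (hA.inter hDB)) hS
          _ = μ.real (D ⁻¹' B ∩ (A ∩ S)) := by
              rw [setIntegral_indicator (hA.inter hDB), setIntegral_const, smul_eq_mul, mul_one]
              congr 1
              ext ω
              simp only [Set.mem_inter_iff]
              tauto
      rw [← ofReal_integral_eq_lintegral_ofReal (integrable_condExp.integrableOn)
        (ae_restrict_of_ae (hPbd.mono fun ω h => h.1)), h1, ofReal_measureReal]
    calc ∫ ω in S, A.indicator (fun ω => g (D ω)) ω ∂μ = ∫ ω in A ∩ S, g (D ω) ∂μ := by
          rw [setIntegral_indicator hA, Set.inter_comm]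
      _ = ∫ b, g b ∂((μ.restrict (A ∩ S)).map D) :=
          (integral_map hD.aemeasurable hg.aestronglyMeasurable).symm
      _ = ∫ ω, g (D ω) ∂((μ.restrict S).withDensity fun ω => ENNReal.ofReal (P ω)) := by
          rw [hν, integral_map hD.aemeasurable hg.aestronglyMeasurable]
      _ = ∫ ω in S, P ω * g (D ω) ∂μ := by
          rw [integral_withDensity_eq_integral_toReal_smul hmeas
            (Eventually.of_forall fun ω => ENNReal.ofReal_lt_top)]
          refine integral_congr_ae (ae_restrict_of_ae (hPbd.mono fun ω h => ?_))
          simp [ENNReal.toReal_ofReal h.1]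
  symm
  refine ae_eq_condExp_of_forall_setIntegral_eq hm (hint.indicator hA)
    (fun S _ _ => integrable_condExp.integrableOn) (fun S hS _ => ?_)
    stronglyMeasurable_condExp.aestronglyMeasurable
  rw [setIntegral_condExp hm (hPg hint) hS, hset S hS]

end CondIndep

/-! ### Measurability with respect to the history. -/

section History

variable {Ω : Type*} {d : ℕ} {X Y : ℕ → Ω → Fin d → ℝ}
  {D : ℕ → Ω → Matrix (Fin d) (Fin d) ℝ}

theorem comap_le_history {n : ℕ} (hn : 1 ≤ n) :
    MeasurableSpace.comap (X n) inferInstance ⊔ MeasurableSpace.comap (Y n) inferInstance ⊔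
      MeasurableSpace.comap (D n) inferInstance ≤ history X Y D n :=
  le_sup_of_le_right (le_iSup₂_of_le n ⟨hn, le_rfl⟩ le_rfl)

theorem measurable_draw_history {n : ℕ} (hn : 1 ≤ n) : Measurable[history X Y D n] (X n) :=
  measurable_iff_comap_le.2 ((le_sup_left.trans le_sup_left).trans (comap_le_history hn))

theorem measurable_replacement_history {n : ℕ} (hn : 1 ≤ n) : Measurable[history X Y D n] (D n) :=
  measurable_iff_comap_le.2 (le_sup_right.trans (comap_le_history hn))

theorem measurable_composition_history (n : ℕ) : Measurable[history X Y D n] (Y n) := by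
  refine measurable_iff_comap_le.2 ?_
  rcases Nat.eq_zero_or_pos n with rfl | hn
  · exact le_sup_left
  · exact (le_sup_right.trans le_sup_left).trans (comap_le_history hn)

theorem measurable_entry (q k : Fin d) : Measurable fun A : Matrix (Fin d) (Fin d) ℝ => A q k :=
  (measurable_pi_apply k).comp (measurable_pi_apply q)

theorem measurableSet_large_history (q k : Fin d) (c : ℝ) {m : ℕ} (hm : 1 ≤ m) :
    MeasurableSet[history X Y D m] {ω | c ≤ |D m ω q k|} :=
  ((measurable_entry q k).abs.comp (measurable_replacement_history hm)) measurableSet_Ici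

end History

/-! ### Reduction of the random urn to the deterministic recursion. -/

section Urn

variable {Ω : Type*} {d : ℕ} [m0 : MeasurableSpace Ω] {μ : Measure Ω} {p : Fin d → ℝ}
  {X Y : ℕ → Ω → Fin d → ℝ} {D : ℕ → Ω → Matrix (Fin d) (Fin d) ℝ}

theorem IsUrn.measurable_composition (hurn : IsUrn μ p X Y D) (n : ℕ) : Measurable (Y n) := by
  induction n with
  | zero => exact hurn.measurable_init
  | succ n ih =>
    have h : Y (n + 1) = fun ω => Y n ω + X (n + 1) ω ᵥ* D (n + 1) ω := funext (hurn.step n)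
    rw [h]
    refine ih.add (measurable_pi_iff.2 fun k => ?_)
    simp only [Matrix.vecMul, dotProduct]
    refine Finset.measurable_sum _ fun q _ => ?_
    exact ((measurable_pi_apply q).comp (hurn.measurable_draw _ n.succ_pos)).mul
      ((measurable_entry q k).comp (hurn.measurable_replacement _ n.succ_pos))

/-- The histories of the urn as a filtration. -/
def IsUrn.filtration (hurn : IsUrn μ p X Y D) : Filtration ℕ m0 where
  seq := history X Y D
  mono' _ _ hij := sup_le_sup le_rfl
    (iSup_mono fun _ => iSup_mono' fun hn => ⟨⟨hn.1, hn.2.trans hij⟩, le_rfl⟩)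
  le' _ := sup_le hurn.measurable_init.comap_le (iSup₂_le fun i hi =>
    sup_le (sup_le (hurn.measurable_draw i hi.1).comap_le (hurn.measurable_composition i).comap_le)
      (hurn.measurable_replacement i hi.1).comap_le)

theorem measurable_posVec : Measurable (posVec (d := d)) :=
  measurable_pi_iff.2 fun k => (measurable_pi_apply k).max measurable_const

theorem measurable_normalization (p : Fin d → ℝ) : Measurable (composition p) := by
  have hs : Measurable fun y : Fin d → ℝ => ∑ j, posVec y j :=
    Finset.measurable_sum _ fun j _ => (measurable_pi_apply j).comp measurable_posVec
  refine measurable_pi_iff.2 fun k => ?_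
  exact Measurable.ite (hs (measurableSet_singleton 0)) measurable_const
    (((measurable_pi_apply k).comp measurable_posVec).div hs)

theorem IsUrn.draw_eq_indicator (hurn : IsUrn μ p X Y D) {n : ℕ} (hn : 1 ≤ n) (k : Fin d) :
    (fun ω => X n ω k) = {ω | X n ω k = 1}.indicator fun _ => (1 : ℝ) := by
  ext ω
  obtain ⟨q, hq⟩ := hurn.draw_unit n hn ω
  by_cases h : k = q
  · subst h; simp [hq]
  · simp [hq, h]

theorem IsUrn.measurableSet_draw (hurn : IsUrn μ p X Y D) {n : ℕ} (hn : 1 ≤ n) (k : Fin d) :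
    MeasurableSet {ω | X n ω k = 1} :=
  ((measurable_pi_apply k).comp (hurn.measurable_draw n hn)) (measurableSet_singleton 1)

theorem IsUrn.draw_mem (hurn : IsUrn μ p X Y D) {n : ℕ} (hn : 1 ≤ n) (ω : Ω) :
    X n ω ∈ stdSimplex ℝ (Fin d) := by
  obtain ⟨q, hq⟩ := hurn.draw_unit n hn ω
  rw [hq]
  exact single_mem_stdSimplex ℝ q

theorem mem_Icc_of_mem_stdSimplex {x : Fin d → ℝ} (hx : x ∈ stdSimplex ℝ (Fin d)) (k : Fin d) :
    0 ≤ x k ∧ x k ≤ 1 :=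
  ⟨hx.1 k, by
    rw [← hx.2]
    exact Finset.single_le_sum (f := x) (fun q _ => hx.1 q) (Finset.mem_univ k)⟩

theorem IsUrn.drawCount_nonneg (hurn : IsUrn μ p X Y D) (ω : Ω) (n : ℕ) (k : Fin d) :
    0 ≤ drawCount X n ω k := by
  rw [drawCount, Finset.sum_apply]
  exact Finset.sum_nonneg fun m hm => (hurn.draw_mem (Finset.mem_Icc.1 hm).1 ω).1 k

theorem IsUrn.sum_drawCount (hurn : IsUrn μ p X Y D) (ω : Ω) (n : ℕ) :
    ∑ k, drawCount X n ω k = n := by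
  simp only [drawCount, Finset.sum_apply]
  rw [Finset.sum_comm, Finset.sum_congr rfl fun m hm =>
    (hurn.draw_mem (Finset.mem_Icc.1 hm).1 ω).2]
  simp

/-- The composition is approximately `N H` if the conditional means of the replacement matrices
average to `H` and the martingale part is negligible. -/
theorem IsUrn.composition_sub_isLittleO (hurn : IsUrn μ p X Y D) {ω : Ω}
    {A : Matrix (Fin d) (Fin d) ℝ}
    (hA : (fun n : ℕ => ∑ m ∈ Finset.Icc 1 n, ‖condMean μ X Y D m ω - A‖) =o[atTop]
      fun n : ℕ => (n : ℝ))
    (hM : (fun n : ℕ => M2 μ X Y D n ω) =o[atTop] fun n : ℕ => (n : ℝ)) :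
    (fun n => Y n ω - drawCount X n ω ᵥ* A) =o[atTop] fun n : ℕ => (n : ℝ) := by
  have h0 : (fun _ : ℕ => Y 0 ω) =o[atTop] fun n : ℕ => (n : ℝ) :=
    isLittleO_const_left.2 (Or.inr (tendsto_norm_atTop_atTop.comp tendsto_natCast_atTop_atTop))
  have h1 : (fun n : ℕ => ∑ m ∈ Finset.Icc 1 n, X m ω ᵥ* (condMean μ X Y D m ω - A)) =o[atTop]
      fun n : ℕ => (n : ℝ) := by
    refine (IsBigO.of_bound 1 (Eventually.of_forall fun n => ?_)).trans_isLittleO hA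
    rw [one_mul, Real.norm_of_nonneg (Finset.sum_nonneg fun m _ => norm_nonneg _)]
    refine norm_sum_le_of_le _ fun m hm => ?_
    obtain ⟨q, hq⟩ := hurn.draw_unit m (Finset.mem_Icc.1 hm).1 ω
    -- A draw selects a row, whose norm is at most the entrywise maximum norm of the matrix.
    rw [hq, Matrix.single_one_vecMul]
    exact norm_le_pi_norm (condMean μ X Y D m ω - A) q
  -- Exact decomposition: `Y n - N n * A` is `Y 0`, plus the drift errors sampled by the draws, plus
  -- `M2`.
  refine ((h0.add h1).add hM).congr_left fun n => ?_
  induction n with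
  | zero => simp [M2, drawCount]
  | succ n ih =>
    simp only [M2, drawCount, sum_Icc_one, Finset.sum_range_succ, Matrix.add_vecMul,
      Matrix.vecMul_sub, hurn.step n] at ih ⊢
    rw [eq_sub_iff_add_eq] at ih ⊢
    rw [← ih]
    abel

variable [IsProbabilityMeasure μ]

/-- The draw counts are asymptotic to the accumulated selection probabilities. -/
theorem IsUrn.ae_drawCount_sub_isLittleO (hurn : IsUrn μ p X Y D) :
    ∀ᵐ ω ∂μ, (fun n => drawCount X n ω - ∑ m ∈ Finset.range n, composition p (Y m ω)) =o[atTop]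
      fun n : ℕ => (n : ℝ) := by
  have key : ∀ k, ∀ᵐ ω ∂μ, (fun n => ∑ m ∈ Finset.range n,
      (X (m + 1) ω k - composition p (Y m ω) k)) =o[atTop] fun n : ℕ => (n : ℝ) := by
    intro k
    have hXm : ∀ n, Measurable[history X Y D (n + 1)] fun ω => X (n + 1) ω k := fun n =>
      (measurable_pi_apply k).comp (measurable_draw_history n.succ_pos)
    have hcm : ∀ n, Measurable[history X Y D n] fun ω => composition p (Y n ω) k := fun n =>
      ((measurable_pi_apply k).comp (measurable_normalization p)).comp
        (measurable_composition_history n)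
    have hle : ∀ n, history X Y D n ≤ m0 := hurn.filtration.le
    have hadp : ∀ n, StronglyMeasurable[history X Y D (n + 1)]
        fun ω => X (n + 1) ω k - composition p (Y n ω) k := fun n =>
      (hXm n).stronglyMeasurable.sub ((hcm n).stronglyMeasurable.mono
        (hurn.filtration.mono n.le_succ))
    have hbd : ∀ n ω, |X (n + 1) ω k - composition p (Y n ω) k| ≤ 1 := fun n ω => by
      have h1 := mem_Icc_of_mem_stdSimplex (hurn.draw_mem n.succ_pos ω) k
      have h2 := mem_Icc_of_mem_stdSimplex (composition_mem_stdSimplex hurn.p_mem (Y n ω)) k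
      rw [abs_le]
      constructor <;> linarith [h1.1, h1.2, h2.1, h2.2]
    have hL2 : ∀ n, MemLp (fun ω => X (n + 1) ω k - composition p (Y n ω) k) 2 μ := fun n =>
      MemLp.of_bound ((hadp n).mono (hle _)).aestronglyMeasurable 1
        (Eventually.of_forall fun ω => hbd n ω)
    refine ae_isLittleO_sum_of_summable_condExp_sq hurn.filtration hadp hL2 (fun n => ?_) ?_
    · have hXi : Integrable (fun ω => X (n + 1) ω k) μ := by
        rw [hurn.draw_eq_indicator n.succ_pos k]
        exact (integrable_const 1).indicator (hurn.measurableSet_draw n.succ_pos k)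
      have hci : Integrable (fun ω => composition p (Y n ω) k) μ :=
        Integrable.of_bound ((hcm n).stronglyMeasurable.mono (hle _)).aestronglyMeasurable 1
          (Eventually.of_forall fun ω => by
            have h2 := mem_Icc_of_mem_stdSimplex (composition_mem_stdSimplex hurn.p_mem (Y n ω)) k
            rw [Real.norm_of_nonneg h2.1]
            exact h2.2)
      have h1 := condExp_sub hXi hci (history X Y D n)
      have h2 : μ[fun ω => composition p (Y n ω) k | history X Y D n]
          = fun ω => composition p (Y n ω) k :=
        condExp_of_stronglyMeasurable (hle n) (hcm n).stronglyMeasurable hci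
      have h3 := hurn.selection n k
      rw [← hurn.draw_eq_indicator n.succ_pos k] at h3
      filter_upwards [h1, h3] with ω h4 h5
      refine h4.trans ?_
      rw [Pi.sub_apply, h2, h5, sub_self, Pi.zero_apply]
    -- The differences are bounded by `1`, so the normalised conditional variances are dominated by
    -- `1 / (n + 1) ^ 2`.
    · have h1 : ∀ᵐ ω ∂μ, ∀ n : ℕ,
          |(μ[fun ω => (X (n + 1) ω k - composition p (Y n ω) k) ^ 2 | history X Y D n]) ω| ≤ 1 :=
        ae_all_iff.2 fun n => ae_bdd_abs_condExp_of_ae_bdd_abs (Eventually.of_forall fun ω => by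
          rw [abs_pow]
          exact pow_le_one₀ (abs_nonneg _) (hbd n ω))
      filter_upwards [h1] with ω h2
      have h3 : Summable fun n : ℕ => 1 / ((n : ℝ) + 1) ^ 2 := by
        exact_mod_cast (summable_nat_add_iff 1).2 (Real.summable_one_div_nat_pow.2 one_lt_two)
      refine Summable.of_norm_bounded h3 fun n => ?_
      rw [norm_div, Real.norm_of_nonneg (by positivity : (0 : ℝ) ≤ ((n : ℝ) + 1) ^ 2)]
      exact div_le_div_of_nonneg_right (h2 n) (by positivity)
  filter_upwards [ae_all_iff.2 key] with ω h
  refine isLittleO_pi_iff.2 fun k => (h k).congr_left fun n => ?_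
  simp [drawCount, sum_Icc_one]

end Urn

/-! ### Negligibility of `M2` by truncation. -/

section Truncation

theorem abs_truncEntry_le {Ω : Type*} {d : ℕ} (D : ℕ → Ω → Matrix (Fin d) (Fin d) ℝ) (q k : Fin d) {c : ℝ}
    (hc : 0 ≤ c) (m : ℕ) (ω : Ω) : |truncEntry D q k c m ω| ≤ c := by
  by_cases h : |D m ω q k| ≤ c <;> simp [truncEntry, h, hc]

variable {Ω : Type*} {d : ℕ} [m0 : MeasurableSpace Ω] {μ : Measure Ω} {p : Fin d → ℝ}
  {X Y : ℕ → Ω → Fin d → ℝ} {D : ℕ → Ω → Matrix (Fin d) (Fin d) ℝ}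

/-- The function of a matrix which truncates its entry `(q, k)`. -/
noncomputable def truncFun (q k : Fin d) (c : ℝ) : Matrix (Fin d) (Fin d) ℝ → ℝ :=
  {A | |A q k| ≤ c}.indicator fun A => A q k

theorem measurable_truncFun (q k : Fin d) (c : ℝ) : Measurable (truncFun q k c) :=
  (measurable_entry q k).indicator
    (measurableSet_le (measurable_entry q k).abs measurable_const)

variable [IsProbabilityMeasure μ]

/-- By the conditional Borel-Cantelli lemma, truncation is eventually inactive. -/
theorem IsUrn.ae_eventually_entry_lt (hurn : IsUrn μ p X Y D) {q k : Fin d} {c : ℕ → ℝ}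
    (hc : TruncationConditions μ X Y D q k c) :
    ∀ᵐ ω ∂μ, ∀ᶠ m in atTop, |D (m + 1) ω q k| < c (m + 1) := by
  -- Time `0` is excluded because `D 0` does not belong to the history.
  set s : ℕ → Set Ω := fun n => if n = 0 then ∅ else {ω | c n ≤ |D n ω q k|} with hs
  have hsm : ∀ n, MeasurableSet[hurn.filtration n] (s n) := fun n => by
    by_cases h : n = 0
    · simp [hs, h]
    · simp only [hs, h, if_false]
      exact measurableSet_large_history q k (c n) (Nat.one_le_iff_ne_zero.2 h)
  filter_upwards [ae_mem_limsup_atTop_iff μ hsm, hc.tail] with ω h1 h2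
  have h3 : ω ∉ limsup s atTop := fun hmem => by
    refine not_tendsto_atTop_of_tendsto_nhds h2.hasSum.tendsto_sum_nat ?_
    exact h1.1 hmem
  rw [mem_limsup_iff_frequently_mem, not_frequently] at h3
  filter_upwards [(tendsto_add_atTop_nat 1).eventually h3] with m hm
  simpa [hs] using hm

/-- The truncated and centred entries, sampled by the draws, satisfy a strong law. -/
theorem IsUrn.ae_sum_truncCentred_isLittleO (hurn : IsUrn μ p X Y D)
    (hind : DrawCondIndep μ X Y D) {q k : Fin d} {c : ℕ → ℝ}
    (hc : TruncationConditions μ X Y D q k c) :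
    ∀ᵐ ω ∂μ, (fun n => ∑ m ∈ Finset.range n,
      X (m + 1) ω q * truncCentred μ X Y D q k (c (m + 1)) (m + 1) ω) =o[atTop]
        fun n : ℕ => (n : ℝ) := by
  have hle : ∀ n, history X Y D n ≤ m0 := hurn.filtration.le
  set T : ℕ → Ω → ℝ := fun n => truncEntry D q k (c (n + 1)) (n + 1) with hT
  set E : ℕ → Ω → ℝ := fun n => μ[T n | history X Y D n] with hE
  have hcpos : ∀ n, 0 ≤ c (n + 1) := fun n => (hc.pos _ n.succ_pos).le
  have hTm : ∀ n, Measurable[history X Y D (n + 1)] (T n) := fun n =>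
    (measurable_truncFun q k _).comp (measurable_replacement_history n.succ_pos)
  have hTint : ∀ n, Integrable (T n) μ := fun n =>
    Integrable.of_bound ((hTm n).stronglyMeasurable.mono (hle _)).aestronglyMeasurable (c (n + 1))
      (Eventually.of_forall fun ω => abs_truncEntry_le D q k (hcpos n) _ ω)
  have hEm : ∀ n, StronglyMeasurable[history X Y D n] (E n) := fun n => stronglyMeasurable_condExp
  have hEbd : ∀ n, ∀ᵐ ω ∂μ, ‖E n ω‖ ≤ c (n + 1) := fun n =>
    ae_bdd_abs_condExp_of_ae_bdd_abs
      (Eventually.of_forall fun ω => abs_truncEntry_le D q k (hcpos n) _ ω)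
  have hXm : ∀ n, Measurable[history X Y D (n + 1)] fun ω => X (n + 1) ω q := fun n =>
    (measurable_pi_apply q).comp (measurable_draw_history n.succ_pos)
  have hX01 : ∀ n ω, 0 ≤ X (n + 1) ω q ∧ X (n + 1) ω q ≤ 1 := fun n ω =>
    mem_Icc_of_mem_stdSimplex (hurn.draw_mem n.succ_pos ω) q
  have hCm : ∀ n, StronglyMeasurable[history X Y D (n + 1)] fun ω => T n ω - E n ω := fun n =>
    (hTm n).stronglyMeasurable.sub ((hEm n).mono (hurn.filtration.mono n.le_succ))
  have hCbd : ∀ n, ∀ᵐ ω ∂μ, ‖T n ω - E n ω‖ ≤ c (n + 1) + c (n + 1) := fun n => by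
    filter_upwards [hEbd n] with ω h
    exact (norm_sub_le _ _).trans (add_le_add (abs_truncEntry_le D q k (hcpos n) _ ω) h)
  have hadp : ∀ n, StronglyMeasurable[history X Y D (n + 1)]
      fun ω => X (n + 1) ω q * (T n ω - E n ω) := fun n => (hXm n).stronglyMeasurable.mul (hCm n)
  have hbd : ∀ n, ∀ᵐ ω ∂μ, ‖X (n + 1) ω q * (T n ω - E n ω)‖ ≤ c (n + 1) + c (n + 1) := fun n => by
    filter_upwards [hCbd n] with ω h
    rw [norm_mul, Real.norm_of_nonneg (hX01 n ω).1]
    exact (mul_le_of_le_one_left (norm_nonneg _) (hX01 n ω).2).trans h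
  have hL2 : ∀ n, MemLp (fun ω => X (n + 1) ω q * (T n ω - E n ω)) 2 μ := fun n =>
    MemLp.of_bound ((hadp n).mono (hle _)).aestronglyMeasurable _ (hbd n)
  have hCL2 : ∀ n, MemLp (fun ω => T n ω - E n ω) 2 μ := fun n =>
    MemLp.of_bound ((hCm n).mono (hle _)).aestronglyMeasurable _ (hCbd n)
  refine ae_isLittleO_sum_of_summable_condExp_sq hurn.filtration hadp hL2 (fun n => ?_) ?_
  · set A : Set Ω := {ω | X (n + 1) ω q = 1} with hA
    have hAm : MeasurableSet A := hurn.measurableSet_draw n.succ_pos q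
    have hXA : (fun ω => X (n + 1) ω q) = A.indicator fun _ => (1 : ℝ) :=
      hurn.draw_eq_indicator n.succ_pos q
    -- The point where conditional independence enters: the sampled truncated entry and its sampled
    -- conditional mean have the same conditional expectation, so their difference is centred.
    have h1 : μ[A.indicator (T n) | history X Y D n] =ᵐ[μ] μ⟦A | history X Y D n⟧ * E n :=
      condExp_indicator_comp (hle n) hAm (hurn.measurable_replacement _ n.succ_pos)
        (fun B hB => hind n q B hB) (measurable_truncFun q k (c (n + 1))) (hTint n)
    have h2 : μ[E n * A.indicator (fun _ => (1 : ℝ)) | history X Y D n]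
        =ᵐ[μ] E n * μ⟦A | history X Y D n⟧ :=
      condExp_stronglyMeasurable_mul_of_bound (hle n) (hEm n)
        ((integrable_const 1).indicator hAm) _ (hEbd n)
    have h3 : (fun ω => X (n + 1) ω q * (T n ω - E n ω))
        = A.indicator (T n) - E n * A.indicator fun _ => (1 : ℝ) := by
      ext ω
      have : X (n + 1) ω q = A.indicator (fun _ => (1 : ℝ)) ω := congrFun hXA ω
      rw [this]
      by_cases h : ω ∈ A <;> simp [h]
    have hEA : Integrable (E n * A.indicator fun _ => (1 : ℝ)) μ :=
      ((integrable_const 1).indicator hAm).bdd_mul ((hEm n).mono (hle n)).aestronglyMeasurable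
        (hEbd n)
    change μ[fun ω => X (n + 1) ω q * (T n ω - E n ω) | history X Y D n] =ᵐ[μ] 0
    rw [h3]
    filter_upwards [condExp_sub ((hTint n).indicator hAm) hEA (history X Y D n), h1, h2]
      with ω h4 h5 h6
    rw [h4, Pi.sub_apply, h5, h6]
    simp [mul_comm]
  · have h1 : ∀ᵐ ω ∂μ, ∀ n : ℕ,
        0 ≤ (μ[fun ω => (X (n + 1) ω q * (T n ω - E n ω)) ^ 2 | history X Y D n]) ω ∧
        (μ[fun ω => (X (n + 1) ω q * (T n ω - E n ω)) ^ 2 | history X Y D n]) ω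
          ≤ (μ[fun ω => (T n ω - E n ω) ^ 2 | history X Y D n]) ω :=
      ae_all_iff.2 fun n => by
        have h2 : 0 ≤ᵐ[μ] μ[fun ω => (X (n + 1) ω q * (T n ω - E n ω)) ^ 2 | history X Y D n] :=
          condExp_nonneg (Eventually.of_forall fun ω => sq_nonneg _)
        have h3 := condExp_mono (m := history X Y D n) (hL2 n).integrable_sq (hCL2 n).integrable_sq
          (Eventually.of_forall fun ω => by
            change (X (n + 1) ω q * (T n ω - E n ω)) ^ 2 ≤ (T n ω - E n ω) ^ 2
            rw [mul_pow]
            exact mul_le_of_le_one_left (sq_nonneg _) (pow_le_one₀ (hX01 n ω).1 (hX01 n ω).2))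
        filter_upwards [h2, h3] with ω h4 h5
        exact ⟨h4, h5⟩
    filter_upwards [h1, hc.variance] with ω h2 h3
    exact h3.of_nonneg_of_le (fun n => div_nonneg (h2 n).1 (by positivity))
      fun n => div_le_div_of_nonneg_right (h2 n).2 (by positivity)

/-- The difference between the centred entry and the truncated centred entry is negligible. -/
theorem IsUrn.ae_sum_entry_sub_truncCentred_isLittleO (hurn : IsUrn μ p X Y D) {q k : Fin d}
    {c : ℕ → ℝ} (hc : TruncationConditions μ X Y D q k c) :
    ∀ᵐ ω ∂μ, (fun n => ∑ m ∈ Finset.range n, X (m + 1) ω q *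
      ((D (m + 1) ω q k - condMean μ X Y D (m + 1) ω q k)
        - truncCentred μ X Y D q k (c (m + 1)) (m + 1) ω)) =o[atTop] fun n : ℕ => (n : ℝ) := by
  set F : ℕ → Ω → ℝ := fun n ω => D (n + 1) ω q k with hF
  set T : ℕ → Ω → ℝ := fun n => truncEntry D q k (c (n + 1)) (n + 1) with hT
  set G : ℕ → Ω → ℝ := fun n => {ω | c (n + 1) ≤ |D (n + 1) ω q k|}.indicator
    fun ω => |D (n + 1) ω q k| with hG
  have hle : ∀ n, history X Y D n ≤ m0 := hurn.filtration.le
  have hFint : ∀ n, Integrable (F n) μ := fun n =>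
    hurn.integrable_replacement _ n.succ_pos q k
  have hTint : ∀ n, Integrable (T n) μ := fun n =>
    (hFint n).indicator (measurableSet_le ((measurable_entry q k).abs.comp
      (hurn.measurable_replacement _ n.succ_pos)) measurable_const)
  have hGint : ∀ n, Integrable (G n) μ := fun n =>
    (hFint n).abs.indicator (hle _ _ (measurableSet_large_history q k _ n.succ_pos))
  -- Both truncation conditions include equality, but there `F = T`, so the overlap is harmless.
  have hFTG : ∀ n ω, |F n ω - T n ω| ≤ G n ω := fun n ω => by
    by_cases h : |D (n + 1) ω q k| ≤ c (n + 1)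
    · have h1 : T n ω = F n ω := Set.indicator_of_mem (s := {ω | |D (n + 1) ω q k| ≤ c (n + 1)}) h _
      rw [h1, sub_self, abs_zero]
      exact Set.indicator_nonneg (fun _ _ => abs_nonneg _) ω
    · have h1 : T n ω = 0 :=
        Set.indicator_of_notMem (s := {ω | |D (n + 1) ω q k| ≤ c (n + 1)}) h _
      have h2 : G n ω = |F n ω| :=
        Set.indicator_of_mem (s := {ω | c (n + 1) ≤ |D (n + 1) ω q k|}) (not_le.1 h).le _
      rw [h1, h2, sub_zero]
  have hcond : ∀ᵐ ω ∂μ, ∀ n, |(μ[F n | history X Y D n]) ω - (μ[T n | history X Y D n]) ω|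
      ≤ (μ[G n | history X Y D n]) ω := ae_all_iff.2 fun n => by
    have h1 := condExp_mono (m := history X Y D n) ((hFint n).sub (hTint n)) (hGint n)
      (Eventually.of_forall fun ω => (abs_le.1 (hFTG n ω)).2)
    have h2 := condExp_mono (m := history X Y D n) ((hTint n).sub (hFint n)) (hGint n)
      (Eventually.of_forall fun ω => by
        have := (abs_le.1 (hFTG n ω)).1
        simp only [Pi.sub_apply]
        linarith)
    filter_upwards [h1, h2, condExp_sub (hFint n) (hTint n) (history X Y D n),
      condExp_sub (hTint n) (hFint n) (history X Y D n)] with ω h3 h4 h5 h6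
    rw [h5, Pi.sub_apply] at h3
    rw [h6, Pi.sub_apply] at h4
    exact abs_le.2 ⟨by linarith, h3⟩
  filter_upwards [hurn.ae_eventually_entry_lt hc, hc.tail_mean, hcond] with ω h1 h2 h3
  have hX : ∀ m, ‖X (m + 1) ω q‖ ≤ 1 := fun m => by
    have := mem_Icc_of_mem_stdSimplex (hurn.draw_mem m.succ_pos ω) q
    rw [Real.norm_of_nonneg this.1]
    exact this.2
  -- Only finitely many terms are nonzero, by Borel-Cantelli; the compensators below are controlled
  -- by `tail_mean`.
  have h4 : (fun n => ∑ m ∈ Finset.range n, X (m + 1) ω q * (F m ω - T m ω)) =o[atTop]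
      fun n : ℕ => (n : ℝ) := by
    refine isLittleO_sum_range_of_tendsto_zero (tendsto_const_nhds.congr' ?_)
    filter_upwards [h1] with m hm
    have : T m ω = F m ω :=
      Set.indicator_of_mem (s := {ω | |D (m + 1) ω q k| ≤ c (m + 1)}) hm.le _
    rw [this, sub_self, mul_zero]
  have h5 : (fun n => ∑ m ∈ Finset.range n, X (m + 1) ω q *
      ((μ[F m | history X Y D m]) ω - (μ[T m | history X Y D m]) ω)) =o[atTop]
      fun n : ℕ => (n : ℝ) := by
    refine (IsBigO.of_bound 1 (Eventually.of_forall fun n => ?_)).trans_isLittleO h2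
    rw [one_mul, sum_Icc_one]
    refine le_trans (norm_sum_le_of_le _ fun m _ => ?_) (le_abs_self _)
    rw [norm_mul]
    exact (mul_le_of_le_one_left (norm_nonneg _) (hX m)).trans (h3 m)
  refine (h4.sub h5).congr_left fun n => ?_
  rw [← Finset.sum_sub_distrib]
  refine Finset.sum_congr rfl fun m _ => ?_
  simp only [condMean, truncCentred, Matrix.of_apply, Nat.add_sub_cancel, hF, hT]
  ring

/-- Under the truncation conditions the martingale `M2` is negligible. -/
theorem IsUrn.ae_M2_isLittleO (hurn : IsUrn μ p X Y D) (hind : DrawCondIndep μ X Y D)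
    (hc : ∀ q k, ∃ c : ℕ → ℝ, TruncationConditions μ X Y D q k c) :
    ∀ᵐ ω ∂μ, (fun n : ℕ => M2 μ X Y D n ω) =o[atTop] fun n : ℕ => (n : ℝ) := by
  have key : ∀ q k, ∀ᵐ ω ∂μ, (fun n => ∑ m ∈ Finset.range n, X (m + 1) ω q *
      (D (m + 1) ω q k - condMean μ X Y D (m + 1) ω q k)) =o[atTop] fun n : ℕ => (n : ℝ) := by
    intro q k
    obtain ⟨c, hc⟩ := hc q k
    filter_upwards [hurn.ae_sum_truncCentred_isLittleO hind hc,
      hurn.ae_sum_entry_sub_truncCentred_isLittleO hc] with ω h1 h2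
    refine (h1.add h2).congr_left fun n => ?_
    rw [← Finset.sum_add_distrib]
    exact Finset.sum_congr rfl fun m _ => by ring
  filter_upwards [ae_all_iff.2 fun q => ae_all_iff.2 (key q)] with ω h
  refine isLittleO_pi_iff.2 fun k => ?_
  refine (IsLittleO.fun_sum (s := Finset.univ) fun q _ => h q k).congr_left fun n => ?_
  rw [M2, sum_Icc_one, Finset.sum_apply, Finset.sum_comm]
  rfl

end Truncation

/-! ### Limits in the irreducible case. -/

section Limits

variable {Ω : Type*} {d : ℕ} [MeasurableSpace Ω] {μ : Measure Ω} {p : Fin d → ℝ}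
  {X Y : ℕ → Ω → Fin d → ℝ} {D : ℕ → Ω → Matrix (Fin d) (Fin d) ℝ}

theorem IsUrn.measurable_drawCount (hurn : IsUrn μ p X Y D) (n : ℕ) :
    Measurable (drawCount X n) := by
  have : drawCount X n = fun ω => ∑ m ∈ Finset.Icc 1 n, X m ω := rfl
  rw [this]
  exact Finset.measurable_sum _ fun m hm => hurn.measurable_draw m (Finset.mem_Icc.1 hm).1

theorem tendsto_of_infDist_singleton {E : Type*} [PseudoMetricSpace E] {x : ℕ → E} {y : E}
    (h : Tendsto (fun n => Metric.infDist (x n) {y}) atTop (𝓝 0)) : Tendsto x atTop (𝓝 y) := by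
  simp only [Metric.infDist_singleton] at h
  exact tendsto_iff_dist_tendsto_zero.2 h

end Limits

end FriedmanUrn

theorem theorem3p1 {Ω : Type*} [MeasurableSpace Ω] (μ : Measure Ω) [IsProbabilityMeasure μ]
    {d : ℕ} (p : Fin d → ℝ) (X Y : ℕ → Ω → Fin d → ℝ)
    (D : ℕ → Ω → Matrix (Fin d) (Fin d) ℝ) (hurn : FriedmanUrn.IsUrn μ p X Y D) :
    (∀ H : Ω → Matrix (Fin d) (Fin d) ℝ, Measurable H →
      (∀ᵐ ω ∂μ, FriedmanUrn.Admissible (H ω)) →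
      (∀ᵐ ω ∂μ, (fun n : ℕ => ∑ m ∈ Finset.Icc 1 n,
        ‖FriedmanUrn.condMean μ X Y D m ω - H ω‖) =o[atTop] fun n : ℕ => (n : ℝ)) →
      (∀ᵐ ω ∂μ, (fun n : ℕ => FriedmanUrn.M2 μ X Y D n ω) =o[atTop] fun n : ℕ => (n : ℝ)) →
      (∀ᵐ ω ∂μ, (FriedmanUrn.leftSimplex (H ω)).Nonempty ∧
        Tendsto (fun n : ℕ => Metric.infDist ((n : ℝ)⁻¹ • Y n ω)
          (FriedmanUrn.lam (H ω) • FriedmanUrn.leftSimplex (H ω))) atTop (𝓝 0) ∧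
        Tendsto (fun n : ℕ => Metric.infDist ((n : ℝ)⁻¹ • FriedmanUrn.posVec (Y n ω))
          (FriedmanUrn.lam (H ω) • FriedmanUrn.leftSimplex (H ω))) atTop (𝓝 0) ∧
        Tendsto (fun n : ℕ => Metric.infDist (FriedmanUrn.composition p (Y n ω))
          (FriedmanUrn.leftSimplex (H ω))) atTop (𝓝 0) ∧
        Tendsto (fun n : ℕ => Metric.infDist ((n : ℝ)⁻¹ • FriedmanUrn.drawCount X n ω)
          (FriedmanUrn.leftSimplex (H ω))) atTop (𝓝 0)) ∧
      ((∀ᵐ ω ∂μ, ¬ FriedmanUrn.Reducible (H ω)) →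
        ∃ v : Ω → Fin d → ℝ, Measurable v ∧
          ∀ᵐ ω ∂μ, FriedmanUrn.leftSimplex (H ω) = {v ω} ∧
            Tendsto (fun n : ℕ => (n : ℝ)⁻¹ • Y n ω) atTop
              (𝓝 (FriedmanUrn.lam (H ω) • v ω)) ∧
            Tendsto (fun n : ℕ => (n : ℝ)⁻¹ • FriedmanUrn.posVec (Y n ω)) atTop
              (𝓝 (FriedmanUrn.lam (H ω) • v ω)) ∧
            Tendsto (fun n : ℕ => FriedmanUrn.composition p (Y n ω)) atTop (𝓝 (v ω)) ∧
            Tendsto (fun n : ℕ => (n : ℝ)⁻¹ • FriedmanUrn.drawCount X n ω) atTop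
              (𝓝 (v ω)))) ∧
    (FriedmanUrn.DrawCondIndep μ X Y D →
      (∀ q k, ∃ c : ℕ → ℝ, FriedmanUrn.TruncationConditions μ X Y D q k c) →
      ∀ᵐ ω ∂μ, (fun n : ℕ => FriedmanUrn.M2 μ X Y D n ω) =o[atTop] fun n : ℕ => (n : ℝ)) := by
  refine ⟨fun H _ hadm hHm hM2 => ?_, hurn.ae_M2_isLittleO⟩
  have hlim : ∀ᵐ ω ∂μ, (FriedmanUrn.leftSimplex (H ω)).Nonempty ∧
      Tendsto (fun n : ℕ => Metric.infDist ((n : ℝ)⁻¹ • Y n ω)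
        (FriedmanUrn.lam (H ω) • FriedmanUrn.leftSimplex (H ω))) atTop (𝓝 0) ∧
      Tendsto (fun n : ℕ => Metric.infDist ((n : ℝ)⁻¹ • FriedmanUrn.posVec (Y n ω))
        (FriedmanUrn.lam (H ω) • FriedmanUrn.leftSimplex (H ω))) atTop (𝓝 0) ∧
      Tendsto (fun n : ℕ => Metric.infDist (FriedmanUrn.composition p (Y n ω))
        (FriedmanUrn.leftSimplex (H ω))) atTop (𝓝 0) ∧
      Tendsto (fun n : ℕ => Metric.infDist ((n : ℝ)⁻¹ • FriedmanUrn.drawCount X n ω)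
        (FriedmanUrn.leftSimplex (H ω))) atTop (𝓝 0) := by
    filter_upwards [hadm, hHm, hM2, hurn.ae_drawCount_sub_isLittleO] with ω h1 h2 h3 h4
    exact FriedmanUrn.path_limits h1 hurn.p_mem (hurn.composition_sub_isLittleO h2 h3) h4
      (hurn.drawCount_nonneg ω) (hurn.sum_drawCount ω)
  refine ⟨hlim, fun hirr => ?_⟩
  have hconv : ∀ᵐ ω ∂μ, ∃ w, FriedmanUrn.leftSimplex (H ω) = {w} ∧
      Tendsto (fun n : ℕ => (n : ℝ)⁻¹ • Y n ω) atTop (𝓝 (FriedmanUrn.lam (H ω) • w)) ∧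
      Tendsto (fun n : ℕ => (n : ℝ)⁻¹ • FriedmanUrn.posVec (Y n ω)) atTop
        (𝓝 (FriedmanUrn.lam (H ω) • w)) ∧
      Tendsto (fun n : ℕ => FriedmanUrn.composition p (Y n ω)) atTop (𝓝 w) ∧
      Tendsto (fun n : ℕ => (n : ℝ)⁻¹ • FriedmanUrn.drawCount X n ω) atTop (𝓝 w) := by
    filter_upwards [hlim, hirr, hadm] with ω ⟨⟨w, hw⟩, h1, h2, h3, h4⟩ h5 h6
    have hS : FriedmanUrn.leftSimplex (H ω) = {w} :=
      (FriedmanUrn.leftSimplex_subsingleton h6.offDiag_nonneg h5).eq_singleton_of_mem hw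
    rw [hS] at h1 h2 h3 h4
    rw [Set.smul_set_singleton] at h1 h2
    exact ⟨w, hS, FriedmanUrn.tendsto_of_infDist_singleton h1,
      FriedmanUrn.tendsto_of_infDist_singleton h2, FriedmanUrn.tendsto_of_infDist_singleton h3,
      FriedmanUrn.tendsto_of_infDist_singleton h4⟩
  -- Measurability of `v` is obtained by taking it as the limit of the draw frequencies; uniqueness
  -- of limits identifies it with the pointwise eigenvector.
  obtain ⟨v, hv, hvlim⟩ := measurable_limit_of_tendsto_metrizable_ae (μ := μ)
    (f := fun (n : ℕ) ω => (n : ℝ)⁻¹ • FriedmanUrn.drawCount X n ω) (L := atTop)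
    (fun n => ((hurn.measurable_drawCount n).const_smul ((n : ℝ)⁻¹)).aemeasurable)
    (hconv.mono fun ω ⟨w, h⟩ => ⟨w, h.2.2.2.2⟩)
  refine ⟨v, hv, ?_⟩
  filter_upwards [hconv, hvlim] with ω ⟨w, h⟩ h1
  rwa [tendsto_nhds_unique h.2.2.2.2 h1] at h
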